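/- Let $\mathbb D$ be the open unit disk, $\mathbb T$ the unit circle and $m$ normalized Lebesgue measure on $\mathbb T$. Let $H^\infty$ be the space of bounded analytic functions on $\mathbb D$ with the supremum norm; for $h\in H^\infty$ and $w\in\mathbb T$ let $h(w)$ denote the nontangential limit of $h$ at $w$, which exists for $m$-almost every $w$. Let $H^1$ be the norm closure in $L^1=L^1(m)$ of the disk algebra $A(\mathbb D)$ (functions continuous on $\overline{\mathbb D}$ and analytic in $\mathbb D$), and let $H^1_0=\{f\in H^1:\int_{\mathbb T} f\,dm=0\}$. Through the pairing $\langle [f],h\rangle=\int_{\mathbb T} f h\,dm$, $H^\infty$ is the dual of $L^1/H^1_0$, and $\ell^\infty$ is the dual of $\ell^1$ through $\langle a,c\rangle=\sum_n a_nc_n$ (complex sequences); weak* topologies refer to these dualities. Let $\epsilon_j=(\delta_{j,n})_n$. Let $(g_n)_{n\in\mathbb N}$ be a sequence in $H^\infty$. The following three conditions are equivalent: (i) There is a weak*-continuous linear map $T:\ell^\infty\to H^\infty$ such that $T\epsilon_j=g_j$ for all $j\in\mathbb N$. (ii) $M:=\sup_{z\in\mathbb D}\sum_{n}|g_n(z)|<\infty$.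 (iii) There is a Borel set $B\subset\mathbb T$ with $m(B)=1$, at every point of which all the nontangential limits $g_n(w)$ exist, such that $\tilde M:=\sup_{w\in B}\sum_{n}|g_n(w)|<\infty$. When these conditions hold: $\tilde M=M$ for every Borel set $B$ of full measure at every point of which all $g_n(w)$ exist; the formula $S[f]=\left(\int_{\mathbb T} f g_n\,dm\right)_n$ defines a bounded linear map $S:L^1/H^1_0\to\ell^1$; every $T$ as in (i) equals $S^*$, i.e. $\langle [f],Tc\rangle=\langle S[f],c\rangle$ for all $f\in L^1$, $c\in\ell^\infty$, and is norm bounded; and $M=\tilde M=\|S\|=\|T\|$. Furthermore, if all the $g_n$ belong to the disk algebra, the three conditions are also equivalent to $M_1:=\sup_{z\in\overline{\mathbb D}}\sum_n|g_n(z)|<\infty$, and to $M_2:=\sup_{z\in\mathbb T}\sum_n|g_n(z)|<\infty$, and $M_1=M_2=M$. -/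

import Mathlib

open MeasureTheory Filter Topology Set Metric
open scoped ENNReal BoundedContinuousFunction

noncomputable section

namespace HardySpace

/-- The open unit disk `𝔻`. -/
abbrev Disk : Type := ball (0 : ℂ) 1

/-- The unit circle `𝕋`, parametrized by the angle `t` modulo `2π`. -/
abbrev Torus : Type := AddCircle (2 * Real.pi)

/-- The point `e^{it}` of the unit circle in `ℂ`. -/
def pt (t : Torus) : ℂ := (AddCircle.toCircle t : ℂ)

instance fact_two_pi_pos : Fact ((0 : ℝ) < 2 * Real.pi) := ⟨Real.two_pi_pos⟩

/-- Normalized Lebesgue (Haar) measure on the unit circle. -/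
abbrev m : Measure Torus := AddCircle.haarAddCircle

/-- `H^∞`: bounded analytic functions on the open unit disk, with the supremum norm. -/
def Hinf : Submodule ℂ (Disk →ᵇ ℂ) where
  carrier := {h | ∃ F : ℂ → ℂ, DifferentiableOn ℂ F (ball 0 1) ∧ ∀ z : Disk, F z = h z}
  add_mem' := by
    rintro a b ⟨F, hF, hFa⟩ ⟨G, hG, hGb⟩
    exact ⟨fun z => F z + G z, hF.add hG, fun z => by simp [hFa, hGb]⟩
  zero_mem' := ⟨fun _ => 0, differentiableOn_const _, fun z => by simp⟩
  smul_mem' := by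
    rintro c a ⟨F, hF, hFa⟩
    exact ⟨fun z => c * F z, hF.const_mul c, fun z => by simp [hFa]⟩

/-- `h` has nontangential limit `l` at the boundary point `e^{it}`: for every `α`,
`h(z) → l` as `z → e^{it}` inside the Stolz region `|z - e^{it}| < α (1 - |z|)`. -/
def HasNTLimit (h : Disk → ℂ) (t : Torus) (l : ℂ) : Prop :=
  ∀ α : ℝ, Tendsto h
    (comap ((↑) : Disk → ℂ) (𝓝 (pt t)) ⊓ 𝓟 {z : Disk | ‖(z : ℂ) - pt t‖ < α * (1 - ‖(z : ℂ)‖)})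
    (𝓝 l)

open Classical in
/-- The boundary function of `h`: its nontangential limit, where that limit exists
(and `0` elsewhere). -/
def bdry (h : Disk → ℂ) (t : Torus) : ℂ :=
  if hl : ∃ l, HasNTLimit h t l then hl.choose else 0

/-- The pairing `⟨f, h⟩ = ∫_𝕋 f h dm` of `f ∈ L¹(𝕋)` and `h ∈ H^∞`. -/
def pairing (f : Lp ℂ 1 m) (h : Hinf) : ℂ := ∫ t, f t * bdry h.1 t ∂m

/-- `F` belongs to the disk algebra `A(𝔻)`. -/
def InDiskAlgebra (F : ℂ → ℂ) : Prop :=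
  ContinuousOn F (closedBall 0 1) ∧ DifferentiableOn ℂ F (ball 0 1)

/-- The disk algebra as a subspace of `L¹(𝕋)`. -/
def diskAlgebraL1 : Submodule ℂ (Lp ℂ 1 m) where
  carrier := {f | ∃ F, InDiskAlgebra F ∧ ∀ᵐ t ∂m, f t = F (pt t)}
  add_mem' := by
    rintro a b ⟨F, hF, hFa⟩ ⟨G, hG, hGb⟩
    refine ⟨fun z => F z + G z, ⟨hF.1.add hG.1, hF.2.add hG.2⟩, ?_⟩
    filter_upwards [hFa, hGb, Lp.coeFn_add a b] with t h1 h2 h3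
    rw [h3, Pi.add_apply, h1, h2]
  zero_mem' := by
    refine ⟨fun _ => 0, ⟨continuousOn_const, differentiableOn_const _⟩, ?_⟩
    filter_upwards [Lp.coeFn_zero ℂ 1 m] with t h
    rw [h, Pi.zero_apply]
  smul_mem' := by
    rintro c a ⟨F, hF, hFa⟩
    refine ⟨fun z => c * F z, ⟨continuousOn_const.mul hF.1, hF.2.const_mul c⟩, ?_⟩
    filter_upwards [hFa, Lp.coeFn_smul c a] with t h1 h2
    rw [h2, Pi.smul_apply, h1, smul_eq_mul]

/-- The Hardy space `H¹`, the norm closure of the disk algebra in `L¹(𝕋)`. -/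
def H1 : Submodule ℂ (Lp ℂ 1 m) := diskAlgebraL1.topologicalClosure

/-- `H¹₀`: the functions in `H¹` that vanish at the origin, i.e. have mean value zero. -/
def H10 : Submodule ℂ (Lp ℂ 1 m) where
  carrier := {f | f ∈ H1 ∧ ∫ t, f t ∂m = 0}
  add_mem' := by
    rintro a b ⟨ha, ha0⟩ ⟨hb, hb0⟩
    refine ⟨H1.add_mem ha hb, ?_⟩
    rw [integral_congr_ae (Lp.coeFn_add a b)]
    simp only [Pi.add_apply]
    rw [integral_add (L1.integrable_coeFn a) (L1.integrable_coeFn b), ha0, hb0, add_zero]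
  zero_mem' := by
    refine ⟨H1.zero_mem, ?_⟩
    rw [integral_congr_ae (Lp.coeFn_zero ℂ 1 m)]
    simp
  smul_mem' := by
    rintro c a ⟨ha, ha0⟩
    refine ⟨H1.smul_mem c ha, ?_⟩
    rw [integral_congr_ae (Lp.coeFn_smul c a)]
    simp only [Pi.smul_apply]
    rw [integral_smul, ha0, smul_zero]

/-- The quotient Banach space `L¹/H¹₀`, predual of `H^∞`. -/
abbrev Predual : Type := Lp ℂ 1 m ⧸ H10

/-- Complex sequences in `ℓ¹`. -/
abbrev ell1 : Type := lp (fun _ : ℕ => ℂ) 1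

/-- Complex sequences in `ℓ^∞`. -/
abbrev ellInf : Type := lp (fun _ : ℕ => ℂ) ∞

/-- The pairing `⟨a, c⟩ = ∑ aₙ cₙ` of `ℓ¹` and `ℓ^∞`. -/
def seqPairing (a : ell1) (c : ellInf) : ℂ := ∑' n, a n * c n

/-- The weak* topology of `ℓ^∞ = (ℓ¹)*`: the coarsest one making all `⟨a, ·⟩`, `a ∈ ℓ¹`,
continuous. -/
@[reducible] def weakStarEllInf : TopologicalSpace ellInf :=
  TopologicalSpace.induced (fun c (a : ell1) => seqPairing a c) inferInstance

/-- The weak* topology of `H^∞ = (L¹/H¹₀)*`: the coarsest one making all `⟨[f], ·⟩ = ⟨f, ·⟩`,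
`f ∈ L¹(𝕋)`, continuous. -/
@[reducible] def weakStarHinf : TopologicalSpace Hinf :=
  TopologicalSpace.induced (fun h (f : Lp ℂ 1 m) => pairing f h) inferInstance

/-- `T : ℓ^∞ → H^∞` is weak*-continuous. -/
def WeakStarContinuous (T : ellInf →ₗ[ℂ] Hinf) : Prop :=
  @Continuous _ _ weakStarEllInf weakStarHinf T

/-- `sup_{z ∈ 𝔻} ∑ₙ |gₙ(z)|`, in `[0, ∞]`. -/
def supDisk (g : ℕ → Hinf) : ℝ≥0∞ := ⨆ z : Disk, ∑' n, ‖(g n).1 z‖ₑ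

/-- `B` is a Borel subset of the circle of full measure at all points of which every `gₙ` has a
boundary value. -/
def IsFullBoundarySet (g : ℕ → Hinf) (B : Set Torus) : Prop :=
  MeasurableSet B ∧ m B = 1 ∧ ∀ t ∈ B, ∀ n, ∃ l, HasNTLimit (g n).1 t l

/-- `sup_{w ∈ B} ∑ₙ |gₙ(w)|`, in `[0, ∞]`, for a set `B` of boundary points. -/
def supBoundary (g : ℕ → Hinf) (B : Set Torus) : ℝ≥0∞ := ⨆ t ∈ B, ∑' n, ‖bdry (g n).1 t‖ₑ

end HardySpace

end

/-! Two facts carry the proof. Tonelli gives `∑ |⟨f, gₙ⟩| ≤ ‖f‖₁ M̃` (`tsum_enorm_pairing_le`), and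
the Poisson kernels `P_z` have `L¹` norm one and satisfy `⟨P_z, h⟩ = h z` (`pairing_poissonL1`).
Testing on `P_z` yields `M ≤ M̃`; radial limits of finite partial sums yield the converse
(`supBoundary_eq_supDisk`). The same tests give `‖S‖ = M` (`enorm_preadjoint`). Boundary values
exist a.e. by Fatou's theorem, obtained from a Lipschitz primitive: it is a.e. differentiable along
the circle, and a harmonic majorant with Cauchy's estimate carries this into Stolz regions.

From (i) to (ii): truncations converge weak*, so `⟨f, T c⟩ = ∑ ⟨f, gₙ⟩ cₙ`. A choice of signs shows
that `c ↦ (T c) z` has norm `∑ |gₙ z|`, and Banach–Steinhaus makes these norms bounded in `z`.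

From (ii) to (i): `T c = ∑ cₙ gₙ` converges locally uniformly because `∑ ∫ |gₙ| dm ≤ M`. Weak*
continuity follows from `⟨f, T c⟩ = ⟨S f, c⟩` (`pairing_sumOperator`). This is checked on
characters, whose pairings can be computed on a circle inside the disk, and extended by density. -/

namespace HardySpace

noncomputable section

/-! ### The circle and the Poisson kernel -/

lemma pt_coe (θ : ℝ) : pt (θ : Torus) = circleMap 0 1 θ := by
  have : 2 * Real.pi / (2 * Real.pi) = 1 := div_self Real.two_pi_pos.ne'
  rw [pt, AddCircle.toCircle_apply_mk, this, one_mul, Circle.coe_exp]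
  simp [circleMap]

@[simp] lemma norm_pt (t : Torus) : ‖pt t‖ = 1 := Circle.norm_coe _

@[fun_prop] lemma continuous_pt : Continuous pt :=
  continuous_subtype_val.comp AddCircle.continuous_toCircle

lemma pt_mem_sphere (t : Torus) : pt t ∈ sphere (0 : ℂ) 1 := by simp

lemma exists_pt_eq {z : ℂ} (hz : ‖z‖ = 1) : ∃ t, pt t = z := by
  refine ⟨(z.arg : ℝ), ?_⟩
  rw [pt_coe, circleMap]
  simpa [hz] using Complex.norm_mul_exp_arg_mul_I z

lemma fourier_eq_pt_zpow (n : ℤ) (t : Torus) : fourier n t = pt t ^ n := by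
  rw [fourier_apply, AddCircle.toCircle_zsmul, Circle.coe_zpow, pt]

lemma integral_torus_eq {E : Type*} [NormedAddCommGroup E] [NormedSpace ℝ E] (f : Torus → E) :
    ∫ t, f t ∂m = (2 * Real.pi)⁻¹ • ∫ θ in (0 : ℝ)..2 * Real.pi, f (θ : Torus) := by
  rw [AddCircle.integral_haarAddCircle, ← AddCircle.intervalIntegral_preimage _ 0, zero_add]

lemma integral_comp_pt {E : Type*} [NormedAddCommGroup E] [NormedSpace ℝ E] (f : ℂ → E) :
    ∫ t, f (pt t) ∂m = Real.circleAverage f 0 1 := by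
  rw [integral_torus_eq, Real.circleAverage_def]
  simp_rw [pt_coe]

lemma integral_comp_smul_pt {E : Type*} [NormedAddCommGroup E] [NormedSpace ℝ E] (f : ℂ → E)
    (r : ℝ) : ∫ t, f (r * pt t) ∂m = Real.circleAverage f 0 r := by
  rw [integral_torus_eq, Real.circleAverage_def]
  simp_rw [pt_coe]
  simp [circleMap]

lemma integrable_of_continuous {E : Type*} [NormedAddCommGroup E] {f : Torus → E}
    (hf : Continuous f) : Integrable f m :=
  hf.integrable_of_hasCompactSupport (HasCompactSupport.of_compactSpace f)

/-- The Poisson kernel of the unit disk. -/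
def poisson (z : ℂ) (t : Torus) : ℝ := poissonKernel 0 z (pt t)

lemma poisson_eq (z : ℂ) (t : Torus) : poisson z t = (1 - ‖z‖ ^ 2) / ‖pt t - z‖ ^ 2 := by
  simp [poisson, poissonKernel_def]

lemma pt_sub_ne_zero {z : ℂ} (hz : ‖z‖ < 1) (t : Torus) : pt t - z ≠ 0 := by
  intro h
  rw [← sub_eq_zero.1 h, norm_pt] at hz
  exact lt_irrefl _ hz

lemma poisson_nonneg {z : ℂ} (hz : ‖z‖ < 1) (t : Torus) : 0 ≤ poisson z t := by
  rw [poisson_eq]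
  have : ‖z‖ ^ 2 ≤ 1 := pow_le_one₀ (norm_nonneg _) hz.le
  exact div_nonneg (by linarith) (by positivity)

lemma continuous_poisson {z : ℂ} (hz : ‖z‖ < 1) : Continuous (poisson z) := by
  simp_rw [funext (poisson_eq z)]
  refine Continuous.div (by fun_prop) (by fun_prop) fun t => ?_
  have := pt_sub_ne_zero hz t
  positivity

lemma InDiskAlgebra.continuous_comp_pt {F : ℂ → ℂ} (hF : InDiskAlgebra F) :
    Continuous fun t => F (pt t) :=
  hF.1.comp_continuous continuous_pt fun t => by simp

lemma InDiskAlgebra.diffContOnCl {F : ℂ → ℂ} (hF : InDiskAlgebra F) :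
    DiffContOnCl ℂ F (ball 0 1) :=
  ⟨hF.2, by rw [closure_ball _ one_ne_zero]; exact hF.1⟩

/-- The Poisson integral formula in the disk algebra. -/
lemma InDiskAlgebra.integral_poisson_mul {F : ℂ → ℂ} (hF : InDiskAlgebra F) {z : ℂ}
    (hz : ‖z‖ < 1) : ∫ t, (poisson z t : ℂ) * F (pt t) ∂m = F z := by
  have h := hF.diffContOnCl.circleAverage_poissonKernel_smul (w := z) (by simpa using hz)
  rw [← integral_comp_pt] at h
  simpa [poisson] using h

/-- The Poisson integral formula for real parts of functions in the disk algebra. -/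
lemma InDiskAlgebra.integral_poisson_mul_re {F : ℂ → ℂ} (hF : InDiskAlgebra F) {z : ℂ}
    (hz : ‖z‖ < 1) : ∫ t, poisson z t * (F (pt t)).re ∂m = (F z).re := by
  rw [← hF.integral_poisson_mul hz, ← RCLike.re_eq_complex_re, ← integral_re]
  · simp
  · exact integrable_of_continuous
      ((Complex.continuous_ofReal.comp (continuous_poisson hz)).mul hF.continuous_comp_pt)

lemma inDiskAlgebra_const (c : ℂ) : InDiskAlgebra fun _ => c :=
  ⟨continuousOn_const, differentiableOn_const _⟩

lemma integral_poisson {z : ℂ} (hz : ‖z‖ < 1) : ∫ t, poisson z t ∂m = 1 := by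
  simpa using (inDiskAlgebra_const 1).integral_poisson_mul_re hz

/-- A majorant on the circle by the real part of a function of the disk algebra extends to the
disk. -/
lemma InDiskAlgebra.norm_le_re {F A : ℂ → ℂ} (hF : InDiskAlgebra F) (hA : InDiskAlgebra A)
    (h : ∀ t, ‖F (pt t)‖ ≤ (A (pt t)).re) {z : ℂ} (hz : ‖z‖ < 1) : ‖F z‖ ≤ (A z).re := by
  rw [← hF.integral_poisson_mul hz, ← hA.integral_poisson_mul_re hz]
  refine norm_integral_le_of_norm_le (integrable_of_continuous
      ((continuous_poisson hz).mul (Complex.continuous_re.comp hA.continuous_comp_pt)))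
    (Eventually.of_forall fun t => ?_)
  rw [norm_mul, Complex.norm_real, Real.norm_of_nonneg (poisson_nonneg hz t)]
  exact mul_le_mul_of_nonneg_left (h t) (poisson_nonneg hz t)

/-- Transfers a.e. differentiability of Lipschitz functions of the angle to Haar measure, which is a
nonzero multiple of Lebesgue measure on one period. -/
lemma ae_of_ae_real {p : Torus → Prop} (h : ∀ᵐ x : ℝ, p (x : Torus)) : ∀ᵐ t ∂m, p t := by
  have h1 : ∀ᵐ x : Ioc (0 : ℝ) (0 + 2 * Real.pi) ∂(Measure.comap Subtype.val volume), p ((x : ℝ) : Torus) :=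
    (ae_restrict_iff_subtype measurableSet_Ioc).1 (ae_restrict_of_ae h)
  have h2 := (AddCircle.measurePreserving_equivIoc (T := 2 * Real.pi)
    (a := 0)).quasiMeasurePreserving.ae h1
  have h3 : ∀ᵐ t : Torus, p t := by
    filter_upwards [h2] with t ht
    rwa [AddCircle.coe_equivIoc] at ht
  rw [AddCircle.volume_eq_smul_haarAddCircle] at h3
  exact (Measure.ae_ennreal_smul_measure_iff (by simp [Real.pi_pos])).1 h3

/-! ### Nontangential limits -/

/-- A sequence of radii increasing to `1`. -/
def radius (k : ℕ) : ℝ := 1 - 1 / ((k : ℝ) + 2)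

lemma radius_pos (k : ℕ) : 0 < radius k := by
  have h : (1 : ℝ) / ((k : ℝ) + 2) < 1 := by
    rw [div_lt_one (by positivity)]
    linarith [(Nat.cast_nonneg k : (0 : ℝ) ≤ k)]
  rw [radius]; linarith

lemma radius_lt_one (k : ℕ) : radius k < 1 := by
  have : (0 : ℝ) < 1 / ((k : ℝ) + 2) := by positivity
  rw [radius]; linarith

lemma tendsto_radius : Tendsto radius atTop (𝓝 1) := by
  have h : Tendsto (fun k : ℕ => 1 / ((k : ℝ) + 2)) atTop (𝓝 0) := by
    simp only [one_div]
    exact tendsto_inv_atTop_zero.comp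
      (tendsto_atTop_add_const_right _ _ tendsto_natCast_atTop_atTop)
  have h1 := h.const_sub 1
  rw [sub_zero] at h1
  exact h1

lemma norm_radius_mul_pt (k : ℕ) (t : Torus) : ‖(radius k : ℂ) * pt t‖ = radius k := by
  rw [norm_mul, norm_pt, mul_one, Complex.norm_real, Real.norm_of_nonneg (radius_pos k).le]

/-- The points `rₖ e^{it}` of the disk, with `rₖ → 1`. -/
def radial (k : ℕ) (t : Torus) : Disk :=
  ⟨radius k * pt t, by rw [mem_ball_zero_iff, norm_radius_mul_pt]; exact radius_lt_one k⟩

lemma continuous_radial (k : ℕ) : Continuous (radial k) :=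
  Continuous.subtype_mk (by fun_prop) _

/-- A Stolz region is empty for `α ≤ 1`; any aperture above `1` contains the radius, and `2` is one
choice. Radial approach thus detects nontangential limits and makes them unique. -/
lemma tendsto_radial (t : Torus) : Tendsto (fun k => radial k t) atTop
    (comap ((↑) : Disk → ℂ) (𝓝 (pt t)) ⊓
      𝓟 {z : Disk | ‖(z : ℂ) - pt t‖ < 2 * (1 - ‖(z : ℂ)‖)}) := by
  refine tendsto_inf.2 ⟨tendsto_comap_iff.2 ?_, tendsto_principal.2 (Eventually.of_forall fun k => ?_)⟩
  · have h : Tendsto (fun k => (radius k : ℂ) * pt t) atTop (𝓝 (((1 : ℝ) : ℂ) * pt t)) :=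
      ((Complex.continuous_ofReal.tendsto 1).comp tendsto_radius).mul_const _
    simpa [radial, Function.comp_def] using h
  · have h1 : (radius k : ℂ) * pt t - pt t = ((radius k - 1 : ℝ) : ℂ) * pt t := by
      push_cast; ring
    have h2 : ‖(radius k : ℂ) * pt t - pt t‖ = 1 - radius k := by
      rw [h1, norm_mul, norm_pt, mul_one, Complex.norm_real, Real.norm_of_nonpos]
      · ring
      · linarith [radius_lt_one k]
    simp only [radial, mem_ofPred_eq, h2, norm_radius_mul_pt]
    linarith [radius_lt_one k]

lemma HasNTLimit.tendsto_radial {h : Disk → ℂ} {t : Torus} {l : ℂ} (hl : HasNTLimit h t l) :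
    Tendsto (fun k => h (radial k t)) atTop (𝓝 l) :=
  (hl 2).comp (HardySpace.tendsto_radial t)

lemma HasNTLimit.bdry_eq {h : Disk → ℂ} {t : Torus} {l : ℂ} (hl : HasNTLimit h t l) :
    bdry h t = l := by
  have hex : ∃ l, HasNTLimit h t l := ⟨l, hl⟩
  rw [bdry, dif_pos hex]
  exact tendsto_nhds_unique hex.choose_spec.tendsto_radial hl.tendsto_radial

lemma tendsto_radial_bdry {h : Disk → ℂ} {t : Torus} (hl : ∃ l, HasNTLimit h t l) :
    Tendsto (fun k => h (radial k t)) atTop (𝓝 (bdry h t)) := by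
  obtain ⟨l, hl⟩ := hl
  rw [hl.bdry_eq]; exact hl.tendsto_radial

lemma InDiskAlgebra.hasNTLimit {F : ℂ → ℂ} (hF : InDiskAlgebra F) {h : Disk → ℂ}
    (hFh : ∀ z : Disk, F z = h z) (t : Torus) : HasNTLimit h t (F (pt t)) := by
  intro α
  refine Tendsto.mono_left ?_ inf_le_left
  have h1 : Tendsto F (𝓝[closedBall 0 1] (pt t)) (𝓝 (F (pt t))) := hF.1 _ (by simp)
  have h2 : Tendsto ((↑) : Disk → ℂ) (comap (↑) (𝓝 (pt t))) (𝓝[closedBall 0 1] (pt t)) :=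
    tendsto_nhdsWithin_iff.2 ⟨tendsto_comap,
      Eventually.of_forall fun z => ball_subset_closedBall z.2⟩
  exact (h1.comp h2).congr fun z => hFh z

/-! ### Fatou's theorem on nontangential limits -/

lemma norm_sub_sq_of_norm_eq_one {w w₀ : ℂ} (hw : ‖w‖ = 1) (hw₀ : ‖w₀‖ = 1) :
    ‖w - w₀‖ ^ 2 = 2 - 2 * (w * (starRingEnd ℂ) w₀).re := by
  rw [← Complex.normSq_eq_norm_sq, Complex.normSq_sub, Complex.normSq_eq_norm_sq,
    Complex.normSq_eq_norm_sq, hw, hw₀]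
  ring

/-- A function of the disk algebra that is `o(|w - w₀|)` along the circle is `o(|z - w₀|)` in the
disk. -/
lemma InDiskAlgebra.isLittleO_of_circle {K : ℂ → ℂ} (hK : InDiskAlgebra K) {w₀ : ℂ}
    (hw₀ : ‖w₀‖ = 1) {L : ℝ} (hL : ∀ w, ‖w‖ = 1 → ‖K w‖ ≤ L * ‖w - w₀‖)
    (hA : ∀ ε > 0, ∃ δ > 0, ∀ w, ‖w‖ = 1 → ‖w - w₀‖ < δ → ‖K w‖ ≤ ε * ‖w - w₀‖)
    {ε : ℝ} (hε : 0 < ε) :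
    ∃ δ > 0, ∀ z, ‖z‖ < 1 → ‖z - w₀‖ < δ → ‖K z‖ ≤ ε * ‖z - w₀‖ := by
  obtain ⟨δ, hδ, hδA⟩ := hA (ε / 4) (by positivity)
  have hL0 : 0 ≤ L := by
    -- The antipode of `w₀` is at positive distance, so the hypothesis there forces `L` to be
    -- nonnegative.
    have h1 := (norm_nonneg _).trans (hL (-w₀) (by simpa using hw₀))
    have h2 : ‖-w₀ - w₀‖ = 2 := by
      rw [← norm_neg, neg_sub, sub_neg_eq_add, ← two_mul, norm_mul, hw₀]; simp
    rw [h2] at h1; linarith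
  -- On the circle `Re A = 2 (ε/4 + (L/δ²) |w - w₀|²)`: the first term covers `|w - w₀| < δ`, the
  -- second the rest, and the factor `2` pays for replacing `|w - w₀|` by `|w - ρ w₀|`. As `A` is
  -- affine, its value in the disk is explicit, and `Re A` is `ε/2` at `w₀`.
  set A : ℂ → ℂ := fun z =>
    ((2 * (ε / 4) : ℝ) : ℂ) + ((2 * (L / δ ^ 2) : ℝ) : ℂ) * (2 - 2 * (z * (starRingEnd ℂ) w₀))
  have hAre : ∀ z, (A z).re =
      2 * (ε / 4 + L / δ ^ 2 * (2 - 2 * (z * (starRingEnd ℂ) w₀).re)) := by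
    intro z
    simp only [A, Complex.add_re, Complex.ofReal_re, Complex.re_ofReal_mul, Complex.sub_re]
    norm_num
    ring
  have hAdisk : InDiskAlgebra A := ⟨by fun_prop, by fun_prop⟩
  have hKA : ∀ z, ‖z‖ < 1 → ‖K z‖ ≤ ‖z - w₀‖ * (A z).re := by
    intro z hz
    -- Continuity of `K z / (z - w₀)` at `w₀` is not available, so the pole is moved to `ρ w₀`
    -- outside the closed disk; afterwards `ρ → 1`.
    have hρ : ∀ ρ : ℝ, 1 < ρ → ‖K z‖ ≤ ‖z - ρ * w₀‖ * (A z).re := by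
      intro ρ hρ
      have hnρ : ‖(ρ : ℂ) * w₀‖ = ρ := by
        rw [norm_mul, hw₀, mul_one, Complex.norm_real, Real.norm_of_nonneg (by linarith)]
      have hne : ∀ w ∈ closedBall (0 : ℂ) 1, w - ρ * w₀ ≠ 0 := by
        intro w hw h
        rw [mem_closedBall_zero_iff, sub_eq_zero.1 h, hnρ] at hw
        linarith
      have hF : InDiskAlgebra fun w => K w / (w - ρ * w₀) :=
        ⟨hK.1.div (by fun_prop) hne,
          hK.2.div (by fun_prop) fun w hw => hne w (ball_subset_closedBall hw)⟩
      have := hF.norm_le_re hAdisk (fun t => ?_) hz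
      · rwa [norm_div, div_le_iff₀' (norm_pos_iff.2 (hne z (by simpa using hz.le)))] at this
      have hw := norm_pt t
      set w := pt t
      rw [norm_div, div_le_iff₀' (norm_pos_iff.2 (hne w (by simp [hw]))), hAre,
        ← norm_sub_sq_of_norm_eq_one hw hw₀]
      have h1 : ‖K w‖ ≤ ‖w - w₀‖ * (ε / 4 + L / δ ^ 2 * ‖w - w₀‖ ^ 2) := by
        rcases lt_or_ge ‖w - w₀‖ δ with h | h
        · refine (hδA w hw h).trans ?_
          rw [mul_comm]
          gcongr
          exact le_add_of_nonneg_right (by positivity)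
        · refine (hL w hw).trans ?_
          rw [mul_comm]
          gcongr
          have h3 : L ≤ L / δ ^ 2 * ‖w - w₀‖ ^ 2 := by
            rw [div_mul_eq_mul_div, le_div_iff₀ (by positivity)]
            gcongr
          linarith
      have h2 : ‖w - w₀‖ ≤ 2 * ‖w - ρ * w₀‖ := by
        have h3 : ‖w - w₀‖ ≤ ‖w - ρ * w₀‖ + ‖(ρ : ℂ) * w₀ - w₀‖ := norm_sub_le_norm_sub_add_norm_sub ..
        have h4 : ‖(ρ : ℂ) * w₀ - w₀‖ = ρ - 1 := by
          have : (ρ : ℂ) * w₀ - w₀ = ((ρ - 1 : ℝ) : ℂ) * w₀ := by push_cast; ring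
          rw [this, norm_mul, hw₀, mul_one, Complex.norm_real, Real.norm_of_nonneg (by linarith)]
        have h5 : ρ - 1 ≤ ‖w - ρ * w₀‖ := by
          have := norm_sub_norm_le ((ρ : ℂ) * w₀) w
          rw [hnρ, hw, norm_sub_rev] at this
          exact this
        linarith
      calc ‖K w‖ ≤ _ := h1
        _ ≤ (2 * ‖w - ρ * w₀‖) * (ε / 4 + L / δ ^ 2 * ‖w - w₀‖ ^ 2) := by gcongr
        _ = _ := by ring
    have hlim : Tendsto (fun ρ : ℝ => ‖z - ρ * w₀‖ * (A z).re) (𝓝[>] 1)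
        (𝓝 (‖z - (1 : ℝ) * w₀‖ * (A z).re)) :=
      (Continuous.tendsto (by fun_prop) 1).mono_left nhdsWithin_le_nhds
    rw [Complex.ofReal_one, one_mul] at hlim
    exact ge_of_tendsto hlim (eventually_nhdsWithin_of_forall hρ)
  have hAcont : Continuous fun z => (A z).re := by fun_prop
  have hA0 : (A w₀).re < ε := by
    have h := norm_sub_sq_of_norm_eq_one hw₀ hw₀
    rw [sub_self, norm_zero, zero_pow two_ne_zero] at h
    rw [hAre, ← h]
    linarith
  obtain ⟨η, hη, hηA⟩ := Metric.eventually_nhds_iff.1 (hAcont.tendsto w₀ |>.eventually_lt_const hA0)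
  refine ⟨η, hη, fun z hz hzw => (hKA z hz).trans ?_⟩
  rw [mul_comm]
  gcongr
  exact (hηA (by rwa [dist_eq_norm])).le

/-- A bounded analytic function has nontangential limits wherever its primitive is differentiable
along the circle. -/
lemma hasNTLimit_of_differentiableAt_primitive {F H : ℂ → ℂ} {C : NNReal} (hC : LipschitzWith C H)
    (hH : ∀ z ∈ ball (0 : ℂ) 1, HasDerivAt H (F z) z) {x : ℝ}
    (hd : DifferentiableAt ℝ (fun θ : ℝ => H (circleMap 0 1 θ)) x) :
    ∃ l, HasNTLimit (fun z => F z) (x : Torus) l := by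
  set w₀ := circleMap 0 1 x with hw₀def
  have hw₀ : ‖w₀‖ = 1 := by simp [w₀]
  have hw₀I : w₀ * Complex.I ≠ 0 := by
    refine mul_ne_zero ?_ Complex.I_ne_zero
    rw [← norm_ne_zero_iff, hw₀]; exact one_ne_zero
  -- Dividing by the velocity `w₀ * I` of the circle turns the derivative along it into the
  -- candidate limit of `F`; then `K` has zero derivative along the circle at `x`.
  set d := deriv (fun θ : ℝ => H (circleMap 0 1 θ)) x / (w₀ * Complex.I)
  set K : ℂ → ℂ := fun z => H z - H w₀ - d * (z - w₀)
  have hKderiv : ∀ z ∈ ball (0 : ℂ) 1, HasDerivAt K (F z - d) z := by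
    intro z hz
    have h1 := ((hH z hz).sub_const (H w₀)).sub (((hasDerivAt_id z).sub_const w₀).const_mul d)
    rw [mul_one] at h1
    exact h1
  have hHc := hC.continuous
  have hK : InDiskAlgebra K :=
    ⟨by fun_prop, fun z hz => (hKderiv z hz).differentiableAt.differentiableWithinAt⟩
  have hKL : ∀ w, ‖K w‖ ≤ (C + ‖d‖) * ‖w - w₀‖ := by
    intro w
    calc ‖K w‖ ≤ ‖H w - H w₀‖ + ‖d * (w - w₀)‖ := norm_sub_le _ _
      _ ≤ C * ‖w - w₀‖ + ‖d‖ * ‖w - w₀‖ := by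
        rw [norm_mul]
        gcongr
        simpa [dist_eq_norm] using hC.dist_le_mul w w₀
      _ = _ := by ring
  have hk : HasDerivAt (fun θ : ℝ => K (circleMap 0 1 θ)) 0 x := by
    have h1 := hasDerivAt_circleMap (0 : ℂ) 1 x
    have h2 := (hd.hasDerivAt.sub_const (H w₀)).sub ((h1.sub_const w₀).const_mul d)
    rw [← hw₀def, div_mul_cancel₀ _ hw₀I, sub_self] at h2
    exact h2
  have hA : ∀ ε > 0, ∃ δ > 0, ∀ w, ‖w‖ = 1 → ‖w - w₀‖ < δ → ‖K w‖ ≤ ε * ‖w - w₀‖ := by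
    intro ε hε
    have hpi := Real.pi_pos
    -- The factor `2 / π` compares arc with chord: `(2 / π) |φ| ≤ |w - w₀|`.
    have h1 := (hasDerivAt_iff_isLittleO.1 hk).def (c := ε * (2 / Real.pi)) (by positivity)
    obtain ⟨η, hη, h2⟩ := Metric.eventually_nhds_iff.1 h1
    refine ⟨η * (2 / Real.pi), by positivity, fun w hw hww => ?_⟩
    set φ := (w / w₀).arg
    have hφ : 2 / Real.pi * |φ| ≤ ‖w - w₀‖ := by
      have hw0 : w ≠ 0 := by rw [← norm_ne_zero_iff, hw]; exact one_ne_zero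
      have hw00 : w₀ ≠ 0 := by rw [← norm_ne_zero_iff, hw₀]; exact one_ne_zero
      rw [← Complex.angle_eq_abs_arg hw0 hw00]
      exact Complex.mul_angle_le_norm_sub hw hw₀
    have hwφ : circleMap 0 1 (x + φ) = w := by
      have h3 : Complex.exp (φ * Complex.I) = w / w₀ := by
        simpa [hw, hw₀] using Complex.norm_mul_exp_arg_mul_I (w / w₀)
      have hw00 : w₀ ≠ 0 := by rw [← norm_ne_zero_iff, hw₀]; exact one_ne_zero
      have h4 : circleMap 0 1 (x + φ) = w₀ * Complex.exp (φ * Complex.I) := by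
        simp [w₀, circleMap, add_mul, Complex.exp_add]
      rw [h4, h3, mul_div_cancel₀ _ hw00]
    have h5 := h2 (y := x + φ) (by
      rw [dist_eq_norm, add_sub_cancel_left, Real.norm_eq_abs]
      have : 2 / Real.pi * |φ| < 2 / Real.pi * η := by linarith
      exact lt_of_mul_lt_mul_left this (by positivity))
    rw [hwφ, ← hw₀def, add_sub_cancel_left] at h5
    have hK0 : K w₀ = 0 := by simp [K]
    rw [hK0, sub_zero, smul_zero, sub_zero, Real.norm_eq_abs, mul_assoc] at h5
    exact h5.trans (by gcongr)
  refine ⟨d, fun α => ?_⟩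
  rw [Metric.tendsto_nhds]
  intro ε hε
  -- If `|ζ - z| = s`, then `|ζ - w₀| ≤ s + 2 |α| s = B s`. Smallness `ε / (2 B)` of `K` thus gives
  -- `|F z - d| ≤ ε / 2` by Cauchy's estimate.
  set B : ℝ := 2 * |α| + 1
  have hB : 0 < B := by positivity
  obtain ⟨δ, hδ, hδK⟩ := hK.isLittleO_of_circle hw₀ (fun w _ => hKL w) hA
    (ε := ε / (2 * B)) (by positivity)
  rw [eventually_inf_principal, eventually_comap]
  filter_upwards [Metric.ball_mem_nhds (pt (x : Torus)) (half_pos hδ)]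
  rintro _ hzδ z rfl hzα
  rw [pt_coe, ← hw₀def] at hzα hzδ
  rw [mem_ball, dist_eq_norm] at hzδ
  have hz1 : ‖(z : ℂ)‖ < 1 := mem_ball_zero_iff.1 z.2
  -- Half the distance to the circle keeps the closed disk about `z` inside the unit disk.
  set s := (1 - ‖(z : ℂ)‖) / 2
  have hs : 0 < s := by simp only [s]; linarith
  have hsδ : s < δ / 2 := by
    have := norm_sub_norm_le w₀ z
    rw [hw₀, norm_sub_rev] at this
    simp only [s]; linarith
  have hsub : closedBall (z : ℂ) s ⊆ ball 0 1 := by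
    intro ζ hζ
    rw [mem_closedBall, dist_eq_norm] at hζ
    rw [mem_ball_zero_iff]
    have := norm_sub_norm_le ζ z
    simp only [s] at hζ
    linarith
  have hdc : DiffContOnCl ℂ K (ball (z : ℂ) s) := by
    refine (hK.2.mono ?_).diffContOnCl
    rw [closure_ball _ hs.ne']; exact hsub
  have hzw : ‖(z : ℂ) - w₀‖ ≤ 2 * |α| * s := by
    have hz0 : 0 ≤ 1 - ‖(z : ℂ)‖ := by linarith
    have : α * (1 - ‖(z : ℂ)‖) ≤ |α| * (1 - ‖(z : ℂ)‖) := by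
      exact mul_le_mul_of_nonneg_right (le_abs_self α) hz0
    have h2 : 2 * |α| * s = |α| * (1 - ‖(z : ℂ)‖) := by simp only [s]; ring
    rw [h2]; exact (le_of_lt hzα).trans this
  have hest := Complex.norm_deriv_le_of_forall_mem_sphere_norm_le (C := ε / (2 * B) * (B * s)) hs hdc
    fun ζ hζ => by
      have hζ' : ‖ζ - z‖ = s := by rwa [mem_sphere, dist_eq_norm] at hζ
      have h1 : ‖ζ - w₀‖ ≤ ‖ζ - z‖ + ‖(z : ℂ) - w₀‖ := norm_sub_le_norm_sub_add_norm_sub ..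
      refine (hδK ζ (mem_ball_zero_iff.1 (hsub (sphere_subset_closedBall hζ))) (by linarith)).trans ?_
      gcongr
      simp only [B]; linarith
  rw [(hKderiv z z.2).deriv] at hest
  rw [dist_eq_norm]
  refine hest.trans_lt ?_
  have : ε / (2 * B) * (B * s) / s = ε / 2 := by field_simp
  rw [this]; linarith

/-- **Fatou's theorem**: a bounded analytic function has nontangential limits almost everywhere. -/
theorem ae_exists_hasNTLimit (h : Hinf) : ∀ᵐ t ∂m, ∃ l, HasNTLimit h.1 t l := by
  obtain ⟨F, hF, hFh⟩ := h.2
  obtain ⟨H₀, hH₀⟩ := hF.isExactOn_ball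
  have hLip : LipschitzOnWith ‖h.1‖₊ H₀ (ball 0 1) := by
    refine (convex_ball (0 : ℂ) 1).lipschitzOnWith_of_nnnorm_hasDerivWithin_le
      (fun z hz => (hH₀ z hz).hasDerivWithinAt) fun z hz => ?_
    rw [hFh ⟨z, hz⟩]
    exact h.1.nnnorm_coe_le_nnnorm _
  -- A global Lipschitz extension gives the primitive values on the circle; the extension may have a
  -- worse constant, which plays no role.
  obtain ⟨H, hH, hHH⟩ := hLip.extend_finite_dimension
  have hderiv : ∀ z ∈ ball (0 : ℂ) 1, HasDerivAt H (F z) z := fun z hz =>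
    (hH₀ z hz).congr_of_eventuallyEq
      (Filter.eventuallyEq_of_mem (isOpen_ball.mem_nhds hz) hHH.symm)
  refine ae_of_ae_real ?_
  filter_upwards [(hH.comp (lipschitzWith_circleMap 0 1)).ae_differentiableAt_real] with x hx
  obtain ⟨l, hl⟩ := hasNTLimit_of_differentiableAt_primitive hH hderiv hx
  refine ⟨l, ?_⟩
  rwa [show (fun z : Disk => F z) = h.1 from funext hFh] at hl

/-! ### Boundary functions and the pairing with `L¹` -/

lemma norm_apply_le (h : Hinf) (z : Disk) : ‖h.1 z‖ ≤ ‖h‖ := h.1.norm_coe_le_norm z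

lemma norm_bdry_le (h : Hinf) (t : Torus) : ‖bdry h.1 t‖ ≤ ‖h‖ := by
  by_cases hl : ∃ l, HasNTLimit h.1 t l
  · exact le_of_tendsto (tendsto_radial_bdry hl).norm (Eventually.of_forall fun k => norm_apply_le h _)
  · rw [bdry, dif_neg hl, norm_zero]; exact norm_nonneg _

lemma continuous_comp_radial (h : Hinf) (k : ℕ) : Continuous fun t => h.1 (radial k t) :=
  h.1.continuous.comp (continuous_radial k)

lemma ae_tendsto_radial_bdry (h : Hinf) :
    ∀ᵐ t ∂m, Tendsto (fun k => h.1 (radial k t)) atTop (𝓝 (bdry h.1 t)) :=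
  (ae_exists_hasNTLimit h).mono fun _ => tendsto_radial_bdry

lemma aestronglyMeasurable_bdry (h : Hinf) : AEStronglyMeasurable (bdry h.1) m :=
  aestronglyMeasurable_of_tendsto_ae atTop
    (fun k => (continuous_comp_radial h k).aestronglyMeasurable) (ae_tendsto_radial_bdry h)

lemma integrable_mul_bdry {f : Torus → ℂ} (hf : Integrable f m) (h : Hinf) :
    Integrable (fun t => f t * bdry h.1 t) m :=
  hf.mul_bdd (aestronglyMeasurable_bdry h) (Eventually.of_forall (norm_bdry_le h))

lemma tendsto_integral_mul_radial {f : Torus → ℂ} (hf : Integrable f m) (h : Hinf) :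
    Tendsto (fun k => ∫ t, f t * h.1 (radial k t) ∂m) atTop (𝓝 (∫ t, f t * bdry h.1 t ∂m)) := by
  refine tendsto_integral_of_dominated_convergence (fun t => ‖f t‖ * ‖h‖) (fun k =>
    hf.aestronglyMeasurable.mul (continuous_comp_radial h k).aestronglyMeasurable)
    (hf.norm.mul_const _) (fun k => Eventually.of_forall fun t => ?_) ?_
  · rw [norm_mul]
    gcongr
    exact norm_apply_le h _
  · filter_upwards [ae_tendsto_radial_bdry h] with t ht
    exact ht.const_mul _

lemma tendsto_pairing (f : Lp ℂ 1 m) (h : Hinf) :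
    Tendsto (fun k => ∫ t, f t * h.1 (radial k t) ∂m) atTop (𝓝 (pairing f h)) :=
  tendsto_integral_mul_radial (L1.integrable_coeFn f) h

lemma integrable_mul_radial (f : Lp ℂ 1 m) (h : Hinf) (k : ℕ) :
    Integrable (fun t => f t * h.1 (radial k t)) m :=
  (L1.integrable_coeFn f).mul_bdd (continuous_comp_radial h k).aestronglyMeasurable
    (Eventually.of_forall fun _ => norm_apply_le h _)

/-- `bdry` is additive only where the limits exist; linearity is exact on the circles of radius `rₖ`
and passes to the limit. -/
lemma pairing_add_right (f : Lp ℂ 1 m) (h₁ h₂ : Hinf) :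
    pairing f (h₁ + h₂) = pairing f h₁ + pairing f h₂ := by
  refine tendsto_nhds_unique (tendsto_pairing f _)
    (((tendsto_pairing f h₁).add (tendsto_pairing f h₂)).congr fun k => ?_)
  rw [← integral_add (integrable_mul_radial f h₁ k) (integrable_mul_radial f h₂ k)]
  simp [mul_add]

lemma pairing_smul_right (f : Lp ℂ 1 m) (c : ℂ) (h : Hinf) :
    pairing f (c • h) = c * pairing f h := by
  refine tendsto_nhds_unique (tendsto_pairing f _)
    (((tendsto_pairing f h).const_mul c).congr fun k => ?_)
  rw [← integral_const_mul]
  simp [mul_left_comm]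

/-- The functional `⟨f, ·⟩` on `H^∞`. -/
def pairingRight (f : Lp ℂ 1 m) : Hinf →ₗ[ℂ] ℂ where
  toFun := pairing f
  map_add' := pairing_add_right f
  map_smul' := pairing_smul_right f

lemma pairing_add_left (f₁ f₂ : Lp ℂ 1 m) (h : Hinf) :
    pairing (f₁ + f₂) h = pairing f₁ h + pairing f₂ h := by
  rw [pairing, pairing, pairing, ← integral_add (integrable_mul_bdry (L1.integrable_coeFn f₁) h)
    (integrable_mul_bdry (L1.integrable_coeFn f₂) h)]
  refine integral_congr_ae ?_
  filter_upwards [Lp.coeFn_add f₁ f₂] with t ht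
  rw [ht, Pi.add_apply, add_mul]

lemma pairing_smul_left (c : ℂ) (f : Lp ℂ 1 m) (h : Hinf) :
    pairing (c • f) h = c * pairing f h := by
  rw [pairing, pairing, ← integral_const_mul]
  refine integral_congr_ae ?_
  filter_upwards [Lp.coeFn_smul c f] with t ht
  rw [ht, Pi.smul_apply, smul_eq_mul, mul_assoc]

lemma norm_pairing_le (f : Lp ℂ 1 m) (h : Hinf) : ‖pairing f h‖ ≤ ‖h‖ * ‖f‖ := by
  rw [L1.norm_eq_integral_norm, ← integral_const_mul]
  refine norm_integral_le_of_norm_le ((L1.integrable_coeFn f).norm.const_mul _)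
    (Eventually.of_forall fun t => ?_)
  rw [norm_mul, mul_comm]
  gcongr
  exact norm_bdry_le h t

/-- The functional `⟨·, h⟩` on `L¹`. -/
def pairingLeft (h : Hinf) : Lp ℂ 1 m →L[ℂ] ℂ :=
  LinearMap.mkContinuous
    { toFun := fun f => pairing f h
      map_add' := fun f₁ f₂ => pairing_add_left f₁ f₂ h
      map_smul' := fun c f => pairing_smul_left c f h } ‖h‖ fun f => norm_pairing_le f h

@[simp] lemma pairingLeft_apply (h : Hinf) (f : Lp ℂ 1 m) : pairingLeft h f = pairing f h := rfl

lemma inDiskAlgebra_dilate {F : ℂ → ℂ} (hF : DifferentiableOn ℂ F (ball 0 1)) (k : ℕ) :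
    InDiskAlgebra fun z => F (radius k * z) := by
  have hmaps : MapsTo (fun z : ℂ => (radius k : ℂ) * z) (closedBall 0 1) (ball 0 1) := by
    intro z hz
    rw [mem_closedBall_zero_iff] at hz
    rw [mem_ball_zero_iff, norm_mul, Complex.norm_real, Real.norm_of_nonneg (radius_pos k).le]
    nlinarith [radius_pos k, radius_lt_one k]
  exact ⟨hF.continuousOn.comp (by fun_prop) hmaps,
    hF.comp (by fun_prop) (hmaps.mono_left ball_subset_closedBall)⟩

lemma tendsto_dilate {F : ℂ → ℂ} (hF : DifferentiableOn ℂ F (ball 0 1)) {z : ℂ}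
    (hz : z ∈ ball (0 : ℂ) 1) : Tendsto (fun k => F (radius k * z)) atTop (𝓝 (F z)) := by
  have h1 : Tendsto (fun k => (radius k : ℂ) * z) atTop (𝓝 (((1 : ℝ) : ℂ) * z)) :=
    ((Complex.continuous_ofReal.tendsto 1).comp tendsto_radius).mul_const _
  rw [Complex.ofReal_one, one_mul] at h1
  exact ((hF.differentiableAt (isOpen_ball.mem_nhds hz)).continuousAt.tendsto).comp h1

/-- The class in `L¹` of a continuous function on the circle. -/
abbrev toL1 (f : C(Torus, ℂ)) : Lp ℂ 1 m := ContinuousMap.toLp (E := ℂ) 1 m ℂ f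

lemma tendsto_pairing_toL1 (f : C(Torus, ℂ)) (h : Hinf) :
    Tendsto (fun k => ∫ t, f t * h.1 (radial k t) ∂m) atTop (𝓝 (pairing (toL1 f) h)) := by
  refine (tendsto_pairing (toL1 f) h).congr fun k => integral_congr_ae ?_
  filter_upwards [ContinuousMap.coeFn_toLp (p := 1) (𝕜 := ℂ) m f] with t ht
  rw [ht]

/-- The Poisson kernel as an element of `L¹`. -/
def poissonL1 (z : Disk) : Lp ℂ 1 m :=
  toL1 ⟨fun t => (poisson z t : ℂ),
    Complex.continuous_ofReal.comp (continuous_poisson (mem_ball_zero_iff.1 z.2))⟩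

/-- The Poisson integral formula in `H^∞`. -/
lemma pairing_poissonL1 (z : Disk) (h : Hinf) : pairing (poissonL1 z) h = h.1 z := by
  obtain ⟨F, hF, hFh⟩ := h.2
  refine tendsto_nhds_unique (tendsto_pairing_toL1 _ h) ?_
  rw [← hFh z]
  refine (tendsto_dilate hF z.2).congr fun k => ?_
  rw [← (inDiskAlgebra_dilate hF k).integral_poisson_mul (mem_ball_zero_iff.1 z.2)]
  refine integral_congr_ae (Eventually.of_forall fun t => ?_)
  simp only [ContinuousMap.coe_mk]
  rw [← hFh (radial k t), radial]

lemma norm_poissonL1 (z : Disk) : ‖poissonL1 z‖ = 1 := by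
  have hz := mem_ball_zero_iff.1 z.2
  rw [L1.norm_eq_integral_norm, ← integral_poisson hz]
  refine integral_congr_ae ?_
  filter_upwards [ContinuousMap.coeFn_toLp (p := 1) (𝕜 := ℂ) m ⟨fun t => (poisson z t : ℂ),
    Complex.continuous_ofReal.comp (continuous_poisson hz)⟩] with t ht
  rw [poissonL1, ht, ContinuousMap.coe_mk, Complex.norm_real,
    Real.norm_of_nonneg (poisson_nonneg hz t)]

lemma InDiskAlgebra.mul {F G : ℂ → ℂ} (hF : InDiskAlgebra F) (hG : InDiskAlgebra G) :
    InDiskAlgebra fun z => F z * G z :=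
  ⟨hF.1.mul hG.1, hF.2.mul hG.2⟩

lemma InDiskAlgebra.integral_eq {F : ℂ → ℂ} (hF : InDiskAlgebra F) : ∫ t, F (pt t) ∂m = F 0 := by
  have := hF.integral_poisson_mul (z := 0) (by simp)
  simpa [poisson_eq] using this

/-- The product of `F` and a dilate of `h` lies in the disk algebra, so its mean is its value at
`0`, which does not depend on the dilation. -/
lemma pairing_of_mem_diskAlgebraL1 {f : Lp ℂ 1 m} (hf : f ∈ diskAlgebraL1) (h : Hinf) :
    pairing f h = (∫ t, f t ∂m) * h.1 ⟨0, by simp⟩ := by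
  obtain ⟨F, hF, hfF⟩ := hf
  obtain ⟨G, hG, hGh⟩ := h.2
  rw [integral_congr_ae hfF, hF.integral_eq, ← hGh]
  refine tendsto_nhds_unique (tendsto_pairing f h) (tendsto_const_nhds.congr fun k => ?_)
  have h1 := (hF.mul (inDiskAlgebra_dilate hG k)).integral_eq
  rw [mul_zero] at h1
  rw [← h1]
  refine integral_congr_ae ?_
  filter_upwards [hfF] with t ht
  rw [ht, ← hGh (radial k t), radial]

/-- Makes the pairing well defined on `L¹/H¹₀`: the mean value identity is closed in `f`, hence
passes from the disk algebra to `H¹`. -/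
lemma pairing_of_mem_H10 {f : Lp ℂ 1 m} (hf : f ∈ H10) (h : Hinf) : pairing f h = 0 := by
  have hcl : IsClosed {f : Lp ℂ 1 m | pairingLeft h f = (∫ t, f t ∂m) * h.1 ⟨0, by simp⟩} :=
    isClosed_eq (pairingLeft h).continuous (continuous_integral.mul_const _)
  have h1 : pairing f h = (∫ t, f t ∂m) * h.1 ⟨0, by simp⟩ :=
    closure_minimal (s := (diskAlgebraL1 : Set (Lp ℂ 1 m)))
      (fun f hf => pairing_of_mem_diskAlgebraL1 hf h) hcl hf.1
  rw [h1, hf.2, zero_mul]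

/-! ### Fourier coefficients of boundary functions -/

/-- Cauchy's theorem on an annulus. The origin is removed because `G` will be `z ^ j * F z` with `j`
possibly negative. -/
lemma circleAverage_eq_of_punctured {G : ℂ → ℂ} (hG : DifferentiableOn ℂ G (ball 0 1 \ {0}))
    {r R : ℝ} (hr : 0 < r) (hrR : r ≤ R) (hR : R < 1) :
    Real.circleAverage G 0 R = Real.circleAverage G 0 r := by
  rw [Real.circleAverage_eq_circleIntegral (hr.trans_le hrR).ne',
    Real.circleAverage_eq_circleIntegral hr.ne']
  congr 1
  refine Complex.circleIntegral_sub_center_inv_smul_eq_of_differentiable_on_annulus_off_countable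
    hr hrR countable_empty (hG.continuousOn.mono ?_) fun z hz =>
      hG.differentiableAt ((isOpen_ball.sdiff isClosed_singleton).mem_nhds ?_)
  · intro z hz
    simp only [Set.mem_sdiff, mem_closedBall_zero_iff, mem_ball_zero_iff, not_lt] at hz
    refine ⟨by simpa using hz.1.trans_lt hR, ?_⟩
    rintro rfl
    simp at hz
    linarith [hz.2]
  · simp only [Set.mem_sdiff, mem_closedBall_zero_iff, mem_ball_zero_iff, not_le] at hz
    refine ⟨by simpa using hz.1.1.trans hR, ?_⟩
    rintro rfl
    have := hz.1.2
    simp at this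
    linarith

lemma integral_fourier_mul_radial {F : ℂ → ℂ} (h : Hinf) (hFh : ∀ z : Disk, F z = h.1 z) (j : ℤ)
    (k : ℕ) : (radius k : ℂ) ^ j * ∫ t, fourier j t * h.1 (radial k t) ∂m =
      Real.circleAverage (fun z => z ^ j * F z) 0 (radius k) := by
  rw [← integral_comp_smul_pt, ← integral_const_mul]
  refine integral_congr_ae (Eventually.of_forall fun t => ?_)
  simp only
  rw [← hFh (radial k t), fourier_eq_pt_zpow, mul_zpow, mul_assoc, radial]

/-- The Fourier coefficients of the boundary function are determined by the values on a smaller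
circle. -/
lemma pairing_fourierLp (j : ℤ) (h : Hinf) : pairing (fourierLp 1 j) h =
    (radius 0 : ℂ) ^ j * ∫ t, fourier j t * h.1 (radial 0 t) ∂m := by
  obtain ⟨F, hF, hFh⟩ := h.2
  have hG : DifferentiableOn ℂ (fun z => z ^ j * F z) (ball 0 1 \ {0}) := fun z hz =>
    ((differentiableAt_zpow.2 (Or.inl hz.2)).differentiableWithinAt).mul
      ((hF z hz.1).mono Set.sdiff_subset)
  have h1 : ∀ k, (radius k : ℂ) ^ j * ∫ t, fourier j t * h.1 (radial k t) ∂m =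
      (radius 0 : ℂ) ^ j * ∫ t, fourier j t * h.1 (radial 0 t) ∂m := by
    intro k
    rw [integral_fourier_mul_radial h hFh, integral_fourier_mul_radial h hFh]
    rcases le_total (radius 0) (radius k) with hk | hk
    · exact circleAverage_eq_of_punctured hG (radius_pos 0) hk (radius_lt_one k)
    · exact (circleAverage_eq_of_punctured hG (radius_pos k) hk (radius_lt_one 0)).symm
  have h2 : Tendsto (fun k => (radius k : ℂ) ^ j) atTop (𝓝 (((1 : ℝ) : ℂ) ^ j)) :=
    ((Complex.continuous_ofReal.tendsto 1).comp tendsto_radius).zpow₀ j (Or.inl (by simp))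
  have h3 := h2.mul (tendsto_pairing_toL1 (fourier j) h)
  simp only [h1, Complex.ofReal_one, one_zpow, one_mul] at h3
  exact tendsto_nhds_unique h3 tendsto_const_nhds

/-! ### Suprema over the disk and over the boundary -/

/-- Tonelli moves the sum under the integral, where `∑ |gₙ|` is a.e. at most the supremum over `B`.
-/
lemma tsum_enorm_pairing_le {g : ℕ → Hinf} {B : Set Torus} (hB : IsFullBoundarySet g B)
    (f : Lp ℂ 1 m) : ∑' n, ‖pairing f (g n)‖ₑ ≤ ‖f‖ₑ * supBoundary g B := by
  have hmeas : ∀ n, AEMeasurable (fun t => ‖f t * bdry (g n).1 t‖ₑ) m := fun n =>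
    (integrable_mul_bdry (L1.integrable_coeFn f) (g n)).aestronglyMeasurable.enorm
  have hBae : ∀ᵐ t ∂m, t ∈ B := (mem_ae_iff_prob_eq_one hB.1).2 hB.2.1
  calc ∑' n, ‖pairing f (g n)‖ₑ ≤ ∑' n, ∫⁻ t, ‖f t * bdry (g n).1 t‖ₑ ∂m :=
        ENNReal.tsum_le_tsum fun n => enorm_integral_le_lintegral_enorm _
    _ = ∫⁻ t, ∑' n, ‖f t * bdry (g n).1 t‖ₑ ∂m := (lintegral_tsum hmeas).symm
    _ ≤ ∫⁻ t, ‖f t‖ₑ * supBoundary g B ∂m := by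
        refine lintegral_mono_ae ?_
        filter_upwards [hBae] with t ht
        simp_rw [enorm_mul, ENNReal.tsum_mul_left]
        gcongr
        exact le_iSup₂ (f := fun t _ => ∑' n, ‖bdry (g n).1 t‖ₑ) t ht
    _ = ‖f‖ₑ * supBoundary g B := by
        rw [lintegral_mul_const'' _ (Lp.aestronglyMeasurable f).enorm, Lp.enorm_def,
          eLpNorm_one_eq_lintegral_enorm]

lemma enorm_poissonL1 (z : Disk) : ‖poissonL1 z‖ₑ = 1 := by
  rw [← ofReal_norm, norm_poissonL1, ENNReal.ofReal_one]

lemma sum_le_supDisk (g : ℕ → Hinf) (z : Disk) : ∑' n, ‖(g n).1 z‖ₑ ≤ supDisk g :=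
  le_iSup (fun z : Disk => ∑' n, ‖(g n).1 z‖ₑ) z

theorem supBoundary_eq_supDisk {g : ℕ → Hinf} {B : Set Torus} (hB : IsFullBoundarySet g B) :
    supBoundary g B = supDisk g := by
  apply le_antisymm
  · refine iSup₂_le fun t ht => ?_
    -- Radial limits commute with finite sums only, so the series is read as a supremum of finite
    -- sums.
    rw [ENNReal.tsum_eq_iSup_sum]
    refine iSup_le fun s => ?_
    refine le_of_tendsto (tendsto_finsetSum s fun n _ =>
      (tendsto_radial_bdry (hB.2.2 t ht n)).enorm) (Eventually.of_forall fun k => ?_)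
    exact (ENNReal.sum_le_tsum s).trans (sum_le_supDisk g (radial k t))
  · refine iSup_le fun z => ?_
    simpa only [pairing_poissonL1, enorm_poissonL1, one_mul] using
      tsum_enorm_pairing_le hB (poissonL1 z)

lemma exists_isFullBoundarySet (g : ℕ → Hinf) : ∃ B, IsFullBoundarySet g B := by
  have h : ∀ᵐ t ∂m, ∀ n, ∃ l, HasNTLimit (g n).1 t l := ae_all_iff.2 fun n => ae_exists_hasNTLimit _
  obtain ⟨B, hBae, hBmeas, hB⟩ := h.exists_measurable_mem
  exact ⟨B, hBmeas, (mem_ae_iff_prob_eq_one hBmeas).1 hBae, hB⟩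

/-! ### Sequence spaces -/

lemma tsum_enorm_eq {a : ℕ → ℂ} (ha : Summable fun n => ‖a n‖) :
    ∑' n, ‖a n‖ₑ = ENNReal.ofReal (∑' n, ‖a n‖) := by
  rw [ENNReal.ofReal_tsum_of_nonneg (fun _ => norm_nonneg _) ha]
  simp_rw [ofReal_norm]

lemma summable_norm_of_tsum_enorm {a : ℕ → ℂ} (ha : ∑' n, ‖a n‖ₑ ≠ ∞) :
    Summable fun n => ‖a n‖ := by
  have h := ENNReal.summable_toReal ha
  simpa using h

lemma summable_norm_ell1 (a : ell1) : Summable fun n => ‖a n‖ := by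
  simpa using (lp.memℓp a).summable (by simp)

lemma norm_ell1 (a : ell1) : ‖a‖ = ∑' n, ‖a n‖ := by
  rw [lp.norm_eq_tsum_rpow (by simp)]
  simp

lemma enorm_ell1 (a : ell1) : ‖a‖ₑ = ∑' n, ‖a n‖ₑ := by
  rw [tsum_enorm_eq (summable_norm_ell1 a), ← ofReal_norm, norm_ell1]

lemma norm_mul_ellInf_le (a : ℂ) (c : ellInf) (n : ℕ) : ‖a * c n‖ ≤ ‖a‖ * ‖c‖ := by
  rw [norm_mul]
  gcongr
  exact lp.norm_apply_le_norm ENNReal.top_ne_zero c n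

lemma summable_norm_mul_ellInf {a : ℕ → ℂ} (ha : Summable fun n => ‖a n‖) (c : ellInf) :
    Summable fun n => ‖a n * c n‖ :=
  (ha.mul_right ‖c‖).of_nonneg_of_le (fun _ => norm_nonneg _) fun n => norm_mul_ellInf_le _ c n

lemma norm_tsum_mul_ellInf_le {a : ℕ → ℂ} (ha : Summable fun n => ‖a n‖) (c : ellInf) :
    ‖∑' n, a n * c n‖ ≤ (∑' n, ‖a n‖) * ‖c‖ := by
  rw [← tsum_mul_right]
  exact (norm_tsum_le_tsum_norm (summable_norm_mul_ellInf ha c)).trans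
    ((summable_norm_mul_ellInf ha c).tsum_le_tsum (fun n => norm_mul_ellInf_le _ c n)
      (ha.mul_right _))

lemma hasSum_seqPairing (a : ell1) (c : ellInf) : HasSum (fun n => a n * c n) (seqPairing a c) :=
  (summable_norm_mul_ellInf (summable_norm_ell1 a) c).of_norm.hasSum

/-- The functional `⟨·, c⟩` on `ℓ¹`. -/
def seqPairingLeft (c : ellInf) : ell1 →L[ℂ] ℂ :=
  LinearMap.mkContinuous
    { toFun := fun a => seqPairing a c
      map_add' := fun a b => by
        refine ((hasSum_seqPairing a c).add (hasSum_seqPairing b c)).unique ?_ |>.symm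
        simpa [add_mul] using hasSum_seqPairing (a + b) c
      map_smul' := fun r a => by
        refine ((hasSum_seqPairing a c).mul_left r).unique ?_ |>.symm
        simpa [mul_assoc] using hasSum_seqPairing (r • a) c } ‖c‖ fun a =>
    (norm_tsum_mul_ellInf_le (summable_norm_ell1 a) c).trans_eq (by rw [mul_comm, ← norm_ell1])

/-- Every complex sequence is normed by a sequence of unimodular or vanishing coefficients. -/
lemma exists_sign (a : ℕ → ℂ) : ∃ c : ellInf, ‖c‖ ≤ 1 ∧ ∀ n, a n * c n = ‖a n‖ := by
  have hle : ∀ n, ‖(starRingEnd ℂ) (a n) / ‖a n‖‖ ≤ 1 := fun n => by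
    rw [norm_div, Complex.norm_conj, Complex.norm_real, norm_norm]
    exact div_self_le_one _
  refine ⟨⟨fun n => (starRingEnd ℂ) (a n) / ‖a n‖, memℓp_infty ⟨1, ?_⟩⟩,
    lp.norm_le_of_forall_le zero_le_one hle, fun n => ?_⟩
  · rintro _ ⟨n, rfl⟩
    exact hle n
  · change a n * ((starRingEnd ℂ) (a n) / ‖a n‖) = ‖a n‖
    rcases eq_or_ne (a n) 0 with h | h
    · simp [h]
    · have h1 : (‖a n‖ : ℂ) ≠ 0 := by simpa using h
      rw [← mul_div_assoc, Complex.mul_conj', sq, mul_div_cancel_right₀ _ h1]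

/-! ### Weak*-continuous operators from `ℓ^∞` to `H^∞` -/

/-- The truncations of a bounded sequence. -/
def truncate (N : ℕ) (c : ellInf) : ellInf :=
  ∑ n ∈ Finset.range N, c n • lp.single ∞ n (1 : ℂ)

lemma truncate_apply (N : ℕ) (c : ellInf) (k : ℕ) :
    truncate N c k = if k < N then c k else 0 := by
  rw [truncate, lp.coeFn_sum, Finset.sum_apply]
  simp [lp.single_apply, Pi.single_apply]

lemma seqPairing_truncate (a : ell1) (N : ℕ) (c : ellInf) :
    seqPairing a (truncate N c) = ∑ n ∈ Finset.range N, a n * c n := by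
  rw [seqPairing, tsum_eq_sum (s := Finset.range N)]
  · refine Finset.sum_congr rfl fun n hn => ?_
    rw [truncate_apply, if_pos (Finset.mem_range.1 hn)]
  · intro n hn
    rw [truncate_apply, if_neg (by simpa using hn), mul_zero]

lemma tendsto_truncate (c : ellInf) :
    Tendsto (fun N => truncate N c) atTop (@nhds _ weakStarEllInf c) := by
  rw [nhds_induced, tendsto_comap_iff, tendsto_pi_nhds]
  intro a
  simp only [Function.comp_def, seqPairing_truncate]
  exact (hasSum_seqPairing a c).tendsto_sum_nat

section WeakStar

variable {g : ℕ → Hinf} {T : ellInf →ₗ[ℂ] Hinf}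

lemma WeakStarContinuous.continuous_pairing (hT : WeakStarContinuous T) (f : Lp ℂ 1 m) :
    @Continuous _ _ weakStarEllInf _ fun c => pairing f (T c) := by
  have h : @Continuous _ _ weakStarHinf _ (pairing f) :=
    @Continuous.comp _ _ _ weakStarHinf _ _ (fun h (f : Lp ℂ 1 m) => pairing f h) _
      (continuous_apply f) continuous_induced_dom
  exact @Continuous.comp _ _ _ weakStarEllInf weakStarHinf _ _ _ h hT

lemma WeakStarContinuous.tendsto_sum_pairing (hT : WeakStarContinuous T)
    (hTg : ∀ j, T (lp.single ∞ j (1 : ℂ)) = g j) (f : Lp ℂ 1 m) (c : ellInf) :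
    Tendsto (fun N => ∑ n ∈ Finset.range N, pairing f (g n) * c n) atTop (𝓝 (pairing f (T c))) := by
  have h1 := (@Continuous.tendsto _ _ weakStarEllInf _ _ (hT.continuous_pairing f) c).comp
    (tendsto_truncate c)
  refine h1.congr fun N => ?_
  change pairingRight f (T (truncate N c)) = _
  rw [truncate, map_sum, map_sum]
  refine Finset.sum_congr rfl fun n _ => ?_
  rw [map_smul, map_smul, hTg, smul_eq_mul, mul_comm]
  rfl

/-- With the signs of `⟨f, gₙ⟩` as coefficients, the convergent partial sums are nonnegative and
increasing, which upgrades convergence in order to absolute summability. -/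
lemma WeakStarContinuous.exists_hasSum_norm (hT : WeakStarContinuous T)
    (hTg : ∀ j, T (lp.single ∞ j (1 : ℂ)) = g j) (f : Lp ℂ 1 m) :
    ∃ c : ellInf, ‖c‖ ≤ 1 ∧ HasSum (fun n => ‖pairing f (g n)‖) ‖pairing f (T c)‖ := by
  obtain ⟨c, hc, hcf⟩ := exists_sign fun n => pairing f (g n)
  refine ⟨c, hc, (hasSum_iff_tendsto_nat_of_nonneg (fun _ => norm_nonneg _) _).2 ?_⟩
  refine (hT.tendsto_sum_pairing hTg f c).norm.congr fun N => ?_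
  simp only [hcf]
  rw [← Complex.ofReal_sum, Complex.norm_real, Real.norm_of_nonneg]
  exact Finset.sum_nonneg fun _ _ => norm_nonneg _

lemma WeakStarContinuous.summable_norm_pairing (hT : WeakStarContinuous T)
    (hTg : ∀ j, T (lp.single ∞ j (1 : ℂ)) = g j) (f : Lp ℂ 1 m) :
    Summable fun n => ‖pairing f (g n)‖ :=
  (hT.exists_hasSum_norm hTg f).choose_spec.2.summable

lemma WeakStarContinuous.hasSum_pairing (hT : WeakStarContinuous T)
    (hTg : ∀ j, T (lp.single ∞ j (1 : ℂ)) = g j) (f : Lp ℂ 1 m) (c : ellInf) :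
    HasSum (fun n => pairing f (g n) * c n) (pairing f (T c)) := by
  have h1 := (summable_norm_mul_ellInf (hT.summable_norm_pairing hTg f) c).of_norm.hasSum
  rwa [tendsto_nhds_unique h1.tendsto_sum_nat (hT.tendsto_sum_pairing hTg f c)] at h1

lemma WeakStarContinuous.norm_apply_le (hT : WeakStarContinuous T)
    (hTg : ∀ j, T (lp.single ∞ j (1 : ℂ)) = g j) (z : Disk) (c : ellInf) :
    ‖(T c).1 z‖ ≤ (∑' n, ‖(g n).1 z‖) * ‖c‖ := by
  have h1 := norm_tsum_mul_ellInf_le (hT.summable_norm_pairing hTg (poissonL1 z)) c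
  rw [(hT.hasSum_pairing hTg (poissonL1 z) c).tsum_eq] at h1
  simpa only [pairing_poissonL1] using h1

/-- The norm of evaluation at `z` is attained on the unit ball; this yields both the bound on `M`
and `M ≤ ‖T‖`. -/
lemma WeakStarContinuous.exists_enorm_eq (hT : WeakStarContinuous T)
    (hTg : ∀ j, T (lp.single ∞ j (1 : ℂ)) = g j) (z : Disk) :
    ∃ c : ellInf, ‖c‖ ≤ 1 ∧ ∑' n, ‖(g n).1 z‖ₑ = ‖(T c).1 z‖ₑ := by
  obtain ⟨c, hc, hs⟩ := hT.exists_hasSum_norm hTg (poissonL1 z)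
  simp only [pairing_poissonL1] at hs
  refine ⟨c, hc, ?_⟩
  rw [tsum_enorm_eq hs.summable, hs.tsum_eq, ofReal_norm]

/-- The functional `c ↦ (T c)(z)` on `ℓ^∞`. -/
def WeakStarContinuous.evalCLM (hT : WeakStarContinuous T)
    (hTg : ∀ j, T (lp.single ∞ j (1 : ℂ)) = g j) (z : Disk) : ellInf →L[ℂ] ℂ :=
  LinearMap.mkContinuous
    { toFun := fun c => (T c).1 z
      map_add' := fun _ _ => by simp
      map_smul' := fun _ _ => by simp } (∑' n, ‖(g n).1 z‖) (hT.norm_apply_le hTg z)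

theorem WeakStarContinuous.supDisk_lt_top (hT : WeakStarContinuous T)
    (hTg : ∀ j, T (lp.single ∞ j (1 : ℂ)) = g j) : supDisk g < ∞ := by
  -- `T` is not assumed norm bounded, but each evaluation is, and for fixed `c` the evaluations are
  -- bounded by `‖T c‖`.
  obtain ⟨C, hC⟩ := banach_steinhaus (g := hT.evalCLM hTg) fun c =>
    ⟨‖T c‖, fun z => HardySpace.norm_apply_le (T c) z⟩
  refine lt_of_le_of_lt (iSup_le fun z => ?_) (ENNReal.ofReal_lt_top (r := C))
  obtain ⟨c, hc, hs⟩ := hT.exists_enorm_eq hTg z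
  rw [hs, ← ofReal_norm]
  refine ENNReal.ofReal_le_ofReal ?_
  calc ‖(T c).1 z‖ = ‖hT.evalCLM hTg z c‖ := rfl
    _ ≤ ‖hT.evalCLM hTg z‖ * ‖c‖ := ContinuousLinearMap.le_opNorm _ _
    _ ≤ ‖hT.evalCLM hTg z‖ * 1 := by gcongr
    _ ≤ C := by rw [mul_one]; exact hC z

end WeakStar

lemma summable_norm_apply {g : ℕ → Hinf} (hg : supDisk g < ∞) (z : Disk) :
    Summable fun n => ‖(g n).1 z‖ :=
  summable_norm_of_tsum_enorm ((sum_le_supDisk g z).trans_lt hg).ne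

lemma tsum_norm_apply_le {g : ℕ → Hinf} (hg : supDisk g < ∞) (z : Disk) :
    ∑' n, ‖(g n).1 z‖ ≤ (supDisk g).toReal := by
  rw [← ENNReal.ofReal_le_iff_le_toReal hg.ne, ← tsum_enorm_eq (summable_norm_apply hg z)]
  exact sum_le_supDisk g z

theorem WeakStarContinuous.exists_continuousLinearMap {g : ℕ → Hinf} {T : ellInf →ₗ[ℂ] Hinf}
    (hT : WeakStarContinuous T) (hTg : ∀ j, T (lp.single ∞ j (1 : ℂ)) = g j) :
    ∃ T' : ellInf →L[ℂ] Hinf, (∀ c, T' c = T c) ∧ ‖T'‖ₑ = supDisk g := by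
  have hg := hT.supDisk_lt_top hTg
  have hbound : ∀ c, ‖T c‖ ≤ (supDisk g).toReal * ‖c‖ := fun c =>
    (BoundedContinuousFunction.norm_le (by positivity)).2 fun z =>
      (hT.norm_apply_le hTg z c).trans (by gcongr; exact tsum_norm_apply_le hg z)
  refine ⟨T.mkContinuous _ hbound, fun c => rfl, le_antisymm ?_ (iSup_le fun z => ?_)⟩
  · rw [← ofReal_norm]
    exact ENNReal.ofReal_le_of_le_toReal (T.mkContinuous_norm_le ENNReal.toReal_nonneg hbound)
  · obtain ⟨c, hc, hs⟩ := hT.exists_enorm_eq hTg z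
    rw [hs, ← ofReal_norm, ← ofReal_norm]
    refine ENNReal.ofReal_le_ofReal ?_
    calc ‖(T c).1 z‖ ≤ ‖T.mkContinuous _ hbound c‖ := HardySpace.norm_apply_le (T c) z
      _ ≤ ‖T.mkContinuous _ hbound‖ * ‖c‖ := ContinuousLinearMap.le_opNorm _ _
      _ ≤ ‖T.mkContinuous _ hbound‖ := mul_le_of_le_one_right (ContinuousLinearMap.opNorm_nonneg _) hc

/-! ### The pre-adjoint operator -/

lemma tsum_enorm_pairing_le_supDisk (g : ℕ → Hinf) (f : Lp ℂ 1 m) :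
    ∑' n, ‖pairing f (g n)‖ₑ ≤ ‖f‖ₑ * supDisk g := by
  obtain ⟨B, hB⟩ := exists_isFullBoundarySet g
  rw [← supBoundary_eq_supDisk hB]
  exact tsum_enorm_pairing_le hB f

lemma summable_norm_pairing {g : ℕ → Hinf} (hg : supDisk g < ∞) (f : Lp ℂ 1 m) :
    Summable fun n => ‖pairing f (g n)‖ :=
  summable_norm_of_tsum_enorm ((tsum_enorm_pairing_le_supDisk g f).trans_lt
    (ENNReal.mul_lt_top enorm_lt_top hg)).ne

/-- The sequence `(⟨f, gₙ⟩)ₙ` in `ℓ¹`. -/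
def coeffSeq {g : ℕ → Hinf} (hg : supDisk g < ∞) (f : Lp ℂ 1 m) : ell1 :=
  ⟨fun n => pairing f (g n), memℓp_gen (by simpa using summable_norm_pairing hg f)⟩

lemma norm_coeffSeq_le {g : ℕ → Hinf} (hg : supDisk g < ∞) (f : Lp ℂ 1 m) :
    ‖coeffSeq hg f‖ ≤ (supDisk g).toReal * ‖f‖ := by
  have h : ‖coeffSeq hg f‖ₑ ≤ ‖f‖ₑ * supDisk g :=
    (enorm_ell1 _).trans_le (tsum_enorm_pairing_le_supDisk g f)
  have h1 := ENNReal.toReal_mono (ENNReal.mul_lt_top enorm_lt_top hg).ne h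
  rwa [ENNReal.toReal_mul, toReal_enorm, toReal_enorm, mul_comm] at h1

/-- The operator `f ↦ (⟨f, gₙ⟩)ₙ` from `L¹` to `ℓ¹`. -/
def coeffMap {g : ℕ → Hinf} (hg : supDisk g < ∞) : Lp ℂ 1 m →L[ℂ] ell1 :=
  LinearMap.mkContinuous
    { toFun := coeffSeq hg
      map_add' := fun f₁ f₂ => by ext n; exact pairing_add_left f₁ f₂ (g n)
      map_smul' := fun c f => by ext n; exact pairing_smul_left c f (g n) }
    (supDisk g).toReal (norm_coeffSeq_le hg)

lemma coeffMap_apply {g : ℕ → Hinf} (hg : supDisk g < ∞) (f : Lp ℂ 1 m) (n : ℕ) :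
    coeffMap hg f n = pairing f (g n) := rfl

lemma coeffMap_eq_zero {g : ℕ → Hinf} (hg : supDisk g < ∞) {f : Lp ℂ 1 m} (hf : f ∈ H10) :
    coeffMap hg f = 0 := by
  ext n
  exact pairing_of_mem_H10 hf (g n)

/-- The operator `[f] ↦ (⟨f, gₙ⟩)ₙ` from `L¹/H¹₀` to `ℓ¹`. -/
def preadjoint {g : ℕ → Hinf} (hg : supDisk g < ∞) : Predual →L[ℂ] ell1 :=
  H10.liftQL (coeffMap hg) fun _ hf => coeffMap_eq_zero hg hf

lemma preadjoint_mk {g : ℕ → Hinf} (hg : supDisk g < ∞) (f : Lp ℂ 1 m) :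
    preadjoint hg (Submodule.Quotient.mk f) = coeffMap hg f := rfl

theorem enorm_preadjoint {g : ℕ → Hinf} (hg : supDisk g < ∞) : ‖preadjoint hg‖ₑ = supDisk g := by
  refine le_antisymm ?_ (iSup_le fun z => ?_)
  · rw [← ofReal_norm]
    refine ENNReal.ofReal_le_of_le_toReal
      (ContinuousLinearMap.opNorm_le_bound _ ENNReal.toReal_nonneg fun x => ?_)
    refine le_of_forall_pos_le_add fun ε hε => ?_
    set M := (supDisk g).toReal
    have hM : 0 ≤ M := ENNReal.toReal_nonneg
    -- The representative is nearly norm minimal; `M + 1` keeps the quotient defined for `M = 0` and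
    -- makes the error at most `ε`.
    obtain ⟨f, rfl, hf⟩ := Submodule.Quotient.norm_mk_lt x (ε := ε / (M + 1)) (by positivity)
    rw [preadjoint_mk]
    calc ‖coeffMap hg f‖ ≤ M * ‖f‖ := norm_coeffSeq_le hg f
      _ ≤ M * (‖(Submodule.Quotient.mk f : Predual)‖ + ε / (M + 1)) := by gcongr
      _ = M * ‖(Submodule.Quotient.mk f : Predual)‖ + ε * (M / (M + 1)) := by ring
      _ ≤ _ := by
        gcongr
        exact mul_le_of_le_one_right hε.le ((div_le_one (by positivity)).2 (by linarith))
  · have h1 : ∑' n, ‖(g n).1 z‖ₑ = ‖preadjoint hg (Submodule.Quotient.mk (poissonL1 z))‖ₑ := by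
      rw [enorm_ell1, preadjoint_mk]
      simp only [coeffMap_apply, pairing_poissonL1]
    rw [h1, ← ofReal_norm, ← ofReal_norm]
    refine ENNReal.ofReal_le_ofReal (((preadjoint hg).le_opNorm _).trans
      (mul_le_of_le_one_right (norm_nonneg _) ?_))
    exact (Submodule.Quotient.norm_mk_le _ _).trans (norm_poissonL1 z).le

/-! ### The operator generated by a sequence -/

/-- The Poisson kernel is at most `(1 - r)⁻²` for `|z| ≤ r`. Together with
`summable_integral_norm_bdry` this supplies the majorants of the Weierstrass test for `∑ cₙ gₙ`. -/
lemma norm_apply_le_integral_bdry (h : Hinf) {r : ℝ} (hr : r < 1) (z : Disk)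
    (hz : ‖(z : ℂ)‖ ≤ r) : ‖h.1 z‖ ≤ ((1 - r) ^ 2)⁻¹ * ∫ t, ‖bdry h.1 t‖ ∂m := by
  have hz1 := mem_ball_zero_iff.1 z.2
  have hint : Integrable (fun t => ‖bdry h.1 t‖) m := by
    simpa using (integrable_mul_bdry (integrable_const (1 : ℂ)) h).norm
  rw [← pairing_poissonL1, ← integral_const_mul]
  refine norm_integral_le_of_norm_le (hint.const_mul _) ?_
  filter_upwards [ContinuousMap.coeFn_toLp (p := 1) (𝕜 := ℂ) m ⟨fun t => (poisson z t : ℂ),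
    Complex.continuous_ofReal.comp (continuous_poisson hz1)⟩] with t ht
  rw [poissonL1, ht, norm_mul, ContinuousMap.coe_mk, Complex.norm_real,
    Real.norm_of_nonneg (poisson_nonneg hz1 t), poisson_eq]
  gcongr
  have h1 : 1 - r ≤ ‖pt t - z‖ := by
    have := norm_sub_norm_le (pt t) z
    rw [norm_pt] at this
    linarith
  have h2 : (1 - ‖(z : ℂ)‖ ^ 2) ≤ 1 := by nlinarith [norm_nonneg (z : ℂ)]
  rw [div_eq_mul_inv]
  calc (1 - ‖(z : ℂ)‖ ^ 2) * (‖pt t - z‖ ^ 2)⁻¹ ≤ 1 * (‖pt t - z‖ ^ 2)⁻¹ := by gcongr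
    _ ≤ ((1 - r) ^ 2)⁻¹ := by
      rw [one_mul]
      have : 0 < 1 - r := by linarith
      gcongr

lemma summable_integral_norm_bdry {g : ℕ → Hinf} (hg : supDisk g < ∞) :
    Summable fun n => ∫ t, ‖bdry (g n).1 t‖ ∂m := by
  obtain ⟨B, hB⟩ := exists_isFullBoundarySet g
  have hint : ∀ n, Integrable (bdry (g n).1) m := fun n => by
    simpa using integrable_mul_bdry (integrable_const (1 : ℂ)) (g n)
  have hBae : ∀ᵐ t ∂m, t ∈ B := (mem_ae_iff_prob_eq_one hB.1).2 hB.2.1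
  have h1 : ∑' n, ∫⁻ t, ‖bdry (g n).1 t‖ₑ ∂m ≤ supDisk g := by
    rw [← lintegral_tsum fun n => (hint n).aestronglyMeasurable.enorm]
    calc _ ≤ ∫⁻ _, supDisk g ∂m := by
          refine lintegral_mono_ae ?_
          filter_upwards [hBae] with t ht
          rw [← supBoundary_eq_supDisk hB]
          exact le_iSup₂ (f := fun t _ => ∑' n, ‖bdry (g n).1 t‖ₑ) t ht
      _ = supDisk g := by simp
  refine (ENNReal.summable_toReal (h1.trans_lt hg).ne).congr fun n => ?_
  rw [integral_norm_eq_lintegral_enorm (hint n).aestronglyMeasurable]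

lemma exists_analytic_tsum {g : ℕ → Hinf} (hg : supDisk g < ∞) (c : ellInf) :
    ∃ F : ℂ → ℂ, DifferentiableOn ℂ F (ball 0 1) ∧
      ∀ z : Disk, F z = ∑' n, (g n).1 z * c n := by
  choose G hG hGg using fun n => (g n).2
  refine ⟨fun z => ∑' n, G n z * c n, fun z hz => ?_, fun z => by simp only [hGg]⟩
  obtain ⟨r, hzr, hr⟩ := exists_between (mem_ball_zero_iff.1 hz)
  have hsub : ball (0 : ℂ) r ⊆ ball 0 1 := ball_subset_ball hr.le
  have h1 := Complex.differentiableOn_tsum_of_summable_norm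
    (u := fun n => ((1 - r) ^ 2)⁻¹ * (∫ t, ‖bdry (g n).1 t‖ ∂m) * ‖c‖)
    (F := fun n z => G n z * c n) (((summable_integral_norm_bdry hg).mul_left _).mul_right _)
    (fun n => ((hG n).mono hsub).mul_const (c n)) isOpen_ball fun n w hw => by
      refine (norm_mul_ellInf_le _ c n).trans ?_
      gcongr
      rw [hGg n ⟨w, hsub hw⟩]
      exact norm_apply_le_integral_bdry (g n) hr _ (mem_ball_zero_iff.1 hw).le
  exact (h1.differentiableAt (isOpen_ball.mem_nhds (by simpa using hzr))).differentiableWithinAt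

/-- The function `∑ₙ cₙ gₙ` in `H^∞`. -/
def sumHinf {g : ℕ → Hinf} (hg : supDisk g < ∞) (c : ellInf) : Hinf :=
  ⟨BoundedContinuousFunction.ofNormedAddCommGroup (fun z : Disk => ∑' n, (g n).1 z * c n)
    (by
      obtain ⟨F, hF, hFs⟩ := exists_analytic_tsum hg c
      simp only [← hFs]
      exact hF.continuousOn.comp_continuous continuous_subtype_val fun z => z.2)
    ((supDisk g).toReal * ‖c‖) fun z =>
      (norm_tsum_mul_ellInf_le (summable_norm_apply hg z) c).trans
        (by gcongr; exact tsum_norm_apply_le hg z),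
    exists_analytic_tsum hg c⟩

lemma hasSum_sumHinf {g : ℕ → Hinf} (hg : supDisk g < ∞) (c : ellInf) (z : Disk) :
    HasSum (fun n => (g n).1 z * c n) ((sumHinf hg c).1 z) :=
  (summable_norm_mul_ellInf (summable_norm_apply hg z) c).of_norm.hasSum

/-- The operator `c ↦ ∑ₙ cₙ gₙ` from `ℓ^∞` to `H^∞`. -/
def sumOperator {g : ℕ → Hinf} (hg : supDisk g < ∞) : ellInf →ₗ[ℂ] Hinf where
  toFun := sumHinf hg
  map_add' c d := by
    ext z
    refine (hasSum_sumHinf hg (c + d) z).unique ?_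
    simpa [mul_add] using (hasSum_sumHinf hg c z).add (hasSum_sumHinf hg d z)
  map_smul' r c := by
    ext z
    refine (hasSum_sumHinf hg (r • c) z).unique ?_
    simpa [mul_left_comm] using (hasSum_sumHinf hg c z).mul_left r

lemma sumOperator_single {g : ℕ → Hinf} (hg : supDisk g < ∞) (j : ℕ) :
    sumOperator hg (lp.single ∞ j (1 : ℂ)) = g j := by
  ext z
  refine (hasSum_sumHinf hg _ z).unique ?_
  convert hasSum_single j fun n hn => ?_
  · simp
  · rw [lp.single_apply_ne _ _ _ hn, mul_zero]

/-- The boundary values of `∑ cₙ gₙ` are not known to be the sums of the boundary values. On the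
circle of radius `radius 0 = 1/2` the series converges boundedly at every point, and there dominated
convergence applies. -/
lemma pairing_fourierLp_sumOperator {g : ℕ → Hinf} (hg : supDisk g < ∞) (j : ℤ) (c : ellInf) :
    pairing (fourierLp 1 j) (sumOperator hg c) =
      seqPairing (coeffMap hg (fourierLp 1 j)) c := by
  have hnorm : ∀ t : Torus, ‖fourier j t‖ = 1 := fun t => by
    rw [fourier_eq_pt_zpow, norm_zpow, norm_pt, one_zpow]
  have hlim : Tendsto (fun N => ∫ t, fourier j t *
      ∑ n ∈ Finset.range N, (g n).1 (radial 0 t) * c n ∂m) atTop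
      (𝓝 (∫ t, fourier j t * (sumOperator hg c).1 (radial 0 t) ∂m)) := by
    refine tendsto_integral_of_dominated_convergence (fun _ => (supDisk g).toReal * ‖c‖)
      (fun N => ?_) (integrable_const _) (fun N => Eventually.of_forall fun t => ?_)
      (Eventually.of_forall fun t =>
        (hasSum_sumHinf hg c (radial 0 t)).tendsto_sum_nat.const_mul _)
    · exact ((fourier j).continuous.mul (continuous_finsetSum _ fun n _ =>
        (continuous_comp_radial (g n) 0).mul_const _)).aestronglyMeasurable
    · rw [norm_mul, hnorm, one_mul]
      refine (norm_sum_le_of_le _ fun n _ => norm_mul_ellInf_le _ c n).trans ?_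
      rw [← Finset.sum_mul]
      gcongr
      exact ((summable_norm_apply hg _).sum_le_tsum _ fun _ _ => norm_nonneg _).trans
        (tsum_norm_apply_le hg _)
  refine tendsto_nhds_unique ?_
    (hasSum_seqPairing (coeffMap hg (fourierLp 1 j)) c).tendsto_sum_nat
  rw [pairing_fourierLp]
  refine (hlim.const_mul _).congr fun N => ?_
  simp_rw [coeffMap_apply, pairing_fourierLp, Finset.mul_sum]
  rw [integral_finsetSum, Finset.mul_sum]
  · refine Finset.sum_congr rfl fun n _ => ?_
    rw [mul_assoc, ← integral_mul_const]
    simp_rw [mul_assoc]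
  · intro n _
    exact integrable_of_continuous ((fourier j).continuous.mul
      ((continuous_comp_radial (g n) 0).mul_const _))

/-- Both sides are continuous in `f`, and the characters span a dense subspace of `L¹`. -/
lemma pairing_sumOperator {g : ℕ → Hinf} (hg : supDisk g < ∞) (f : Lp ℂ 1 m) (c : ellInf) :
    pairing f (sumOperator hg c) = seqPairing (coeffMap hg f) c := by
  have h : pairingLeft (sumOperator hg c) = (seqPairingLeft c).comp (coeffMap hg) := by
    refine ContinuousLinearMap.ext_on (s := range (fourierLp (T := 2 * Real.pi) 1)) ?_ ?_
    · exact Submodule.dense_iff_topologicalClosure_eq_top.2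
        (span_fourierLp_closure_eq_top ENNReal.one_ne_top)
    · rintro _ ⟨j, rfl⟩
      exact pairing_fourierLp_sumOperator hg j c
  exact congrArg (fun Λ : Lp ℂ 1 m →L[ℂ] ℂ => Λ f) h

lemma weakStarContinuous_sumOperator {g : ℕ → Hinf} (hg : supDisk g < ∞) :
    WeakStarContinuous (sumOperator hg) := by
  refine continuous_induced_rng.2 (@continuous_pi _ _ _ weakStarEllInf _ _ fun f => ?_)
  simp only [Function.comp_def, pairing_sumOperator hg]
  exact @Continuous.comp _ _ _ weakStarEllInf _ _ _ _ (continuous_apply (coeffMap hg f))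
    continuous_induced_dom

/-! ### Sequences in the disk algebra -/

lemma iSup_sphere_eq_supDisk {g : ℕ → Hinf} {G : ℕ → ℂ → ℂ} (hG : ∀ n, InDiskAlgebra (G n))
    (hGg : ∀ n (z : Disk), G n z = (g n).1 z) :
    (⨆ z ∈ sphere (0 : ℂ) 1, ∑' n, ‖G n z‖ₑ) = supDisk g := by
  have hlim : ∀ n t, HasNTLimit (g n).1 t (G n (pt t)) := fun n t => (hG n).hasNTLimit (hGg n) t
  -- Continuity up to the boundary allows the whole circle as the full set, so no exceptional null
  -- set remains.
  have huniv : IsFullBoundarySet g univ :=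
    ⟨MeasurableSet.univ, measure_univ, fun t _ n => ⟨_, hlim n t⟩⟩
  rw [← supBoundary_eq_supDisk huniv, supBoundary]
  simp only [(hlim _ _).bdry_eq]
  apply le_antisymm
  · refine iSup₂_le fun z hz => ?_
    obtain ⟨t, rfl⟩ := exists_pt_eq (mem_sphere_zero_iff_norm.1 hz)
    exact le_iSup₂ (f := fun t (_ : t ∈ univ) => ∑' n, ‖G n (pt t)‖ₑ) t (mem_univ t)
  · exact iSup₂_le fun t _ =>
      le_iSup₂ (f := fun z (_ : z ∈ sphere (0 : ℂ) 1) => ∑' n, ‖G n z‖ₑ) (pt t) (pt_mem_sphere t)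

lemma iSup_closedBall_eq_supDisk {g : ℕ → Hinf} {G : ℕ → ℂ → ℂ} (hG : ∀ n, InDiskAlgebra (G n))
    (hGg : ∀ n (z : Disk), G n z = (g n).1 z) :
    (⨆ z ∈ closedBall (0 : ℂ) 1, ∑' n, ‖G n z‖ₑ) = supDisk g := by
  apply le_antisymm
  · refine iSup₂_le fun z hz => ?_
    rw [← ball_union_sphere] at hz
    rcases hz with hz | hz
    · simp only [hGg _ ⟨z, hz⟩]
      exact sum_le_supDisk g ⟨z, hz⟩
    · rw [← iSup_sphere_eq_supDisk hG hGg]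
      exact le_iSup₂ (f := fun z (_ : z ∈ sphere (0 : ℂ) 1) => ∑' n, ‖G n z‖ₑ) z hz
  · refine iSup_le fun z => ?_
    simp only [← hGg]
    exact le_iSup₂ (f := fun z (_ : z ∈ closedBall (0 : ℂ) 1) => ∑' n, ‖G n z‖ₑ) (z : ℂ)
      (ball_subset_closedBall z.2)

end

end HardySpace

/-! ### The equivalences, the norm identities and the disk algebra case -/

open HardySpace in
theorem mainTheorem1 (g : ℕ → Hinf) :
    -- the three conditions are equivalent
    [∃ T : ellInf →ₗ[ℂ] Hinf, WeakStarContinuous T ∧ ∀ j, T (lp.single ∞ j (1 : ℂ)) = g j,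
      supDisk g < ∞,
      ∃ B : Set Torus, IsFullBoundarySet g B ∧ supBoundary g B < ∞].TFAE ∧
    -- the two suprema agree, `T` is the adjoint of `S`, and all norms are equal to `M`
    (supDisk g < ∞ →
      (∀ B : Set Torus, IsFullBoundarySet g B → supBoundary g B = supDisk g) ∧
      ∃ S : Predual →L[ℂ] ell1,
        (∀ (f : Lp ℂ 1 m) (n : ℕ), S (Submodule.Quotient.mk f) n = pairing f (g n)) ∧
        ‖S‖ₑ = supDisk g ∧
        ∀ T : ellInf →ₗ[ℂ] Hinf, WeakStarContinuous T →
          (∀ j, T (lp.single ∞ j (1 : ℂ)) = g j) →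
          (∀ (f : Lp ℂ 1 m) (c : ellInf),
            pairing f (T c) = seqPairing (S (Submodule.Quotient.mk f)) c) ∧
          ∃ T' : ellInf →L[ℂ] Hinf, (∀ c, T' c = T c) ∧ ‖T'‖ₑ = supDisk g) ∧
    -- if all `gₙ` lie in the disk algebra, the suprema over the closed disk and over the whole
    -- circle can be used instead
    (∀ G : ℕ → ℂ → ℂ, (∀ n, InDiskAlgebra (G n)) → (∀ n (z : Disk), G n z = (g n).1 z) →
      ((supDisk g < ∞ ↔ (⨆ z ∈ closedBall (0 : ℂ) 1, ∑' n, ‖G n z‖ₑ) < ∞) ∧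
        (⨆ z ∈ closedBall (0 : ℂ) 1, ∑' n, ‖G n z‖ₑ) = supDisk g) ∧
      ((supDisk g < ∞ ↔ (⨆ z ∈ sphere (0 : ℂ) 1, ∑' n, ‖G n z‖ₑ) < ∞) ∧
        (⨆ z ∈ sphere (0 : ℂ) 1, ∑' n, ‖G n z‖ₑ) = supDisk g)) := by
  refine ⟨?_, fun hg => ⟨fun B hB => supBoundary_eq_supDisk hB, preadjoint hg, fun f n => rfl,
    enorm_preadjoint hg, fun T hT hTg => ⟨fun f c => (hT.hasSum_pairing hTg f c).tsum_eq.symm,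
      hT.exists_continuousLinearMap hTg⟩⟩, fun G hG hGg => ?_⟩
  · tfae_have 1 → 2
    | ⟨T, hT, hTg⟩ => hT.supDisk_lt_top hTg
    tfae_have 2 → 1
    | hg => ⟨sumOperator hg, weakStarContinuous_sumOperator hg, sumOperator_single hg⟩
    tfae_have 2 → 3
    | hg => by
      obtain ⟨B, hB⟩ := exists_isFullBoundarySet g
      exact ⟨B, hB, by rwa [supBoundary_eq_supDisk hB]⟩
    tfae_have 3 → 2
    | ⟨B, hB, hfin⟩ => by rwa [← supBoundary_eq_supDisk hB]
    tfae_finish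
  · rw [iSup_closedBall_eq_supDisk hG hGg, iSup_sphere_eq_supDisk hG hGg]
    exact ⟨⟨Iff.rfl, rfl⟩, Iff.rfl, rfl⟩
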